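/- **Setting.** Let $1\le d_x\le d_v\le 3$ and let $\Omega=\Omega_x\times\Omega_v\subset\mathbb R^{d_x}\times\mathbb R^{d_v}$ be a box, with periodic boundary conditions in all variables $z=(x,v)$. Let $\mathcal T$ be a (tensor-product, not necessarily uniform) mesh of $\Omega$ into cuboids, let $h_{\min}$ be the smallest edge length of its cells, and suppose that the edge lengths in direction $z_l$ of any two cells that are (periodically) adjacent in direction $z_l$ differ at most by a factor $\sigma\ge1$ ($\sigma=1$ for uniform grids). For $k\ge1$ let $\mathbb V$ be the space of continuous periodic functions on $\Omega$ that are polynomials of degree at most $k$ in each variable on each cell, with the Lagrange basis $\{\psi_i\}_{i=1}^N$ that comes from fixed reference points $0=r_0<r_1<\dots<r_k=1$ in every direction. Write $(\cdot,\cdot)$ and $\|\cdot\|$ for the inner product and norm of $L^2(\Omega)$, and $\nabla=(\nabla_x,\nabla_v)$ for the gradient, taken cell by cell. For $n=0,\dots,N_T$ let $\boldsymbol E_h^n,\boldsymbol B_h^n:\Omega_x\to\mathbb R^3$ be bounded measurable fields and let $\boldsymbol\beta_h^n=(v,\ \boldsymbol E_h^n+v\times\boldsymbol B_h^n)$, where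 for $d_v<3$ the missing components of $v$ are set to $0$ and where only the first $d_x$ components of $v$ and the first $d_v$ components of $\boldsymbol E_h^n+v\times\boldsymbol B_h^n$ are kept. The first-order viscosity is $\boldsymbol{\mathsf A}^{L,n}=\mathrm{diag}(\varepsilon^{n}_{l})_{l}$, one entry for each of the $d_x+d_v$ coordinates $z_l$, where $\varepsilon^n_l\in\mathbb V$ has the nodal values $$(\varepsilon^n_l)_i=\frac12\,\frac{\Delta z_l}{k}\,\|\beta^n_{h,l}\|_{L^\infty(\operatorname{supp}\psi_i)},\qquad i=1,\dots,N;$$ here $\Delta z_l=\Delta z_l(i)$ is the edge length in direction $z_l$ at node $i$, i.e. any number between the smallest and the largest edge length in direction $z_l$ of the cells containing node $i$. It is assumed that $\boldsymbol{\mathsf A}^{L,n}$ is nonnegative on $\Omega$, so that $(\boldsymbol{\mathsf A}^{L,n})^{1/2}$ makes sense (this is automatic for $k=1$). Let $f_0\in L^2(\Omega)$, let $f_h^0\in\mathbb V$ be its $L^2$-projection (so $f_h^0=f_0$ if $f_0\in\mathbb V$), and let $f_h^n=\sum_i f_i^n\psi_i$ satisfy the forward Euler scheme $$\sum_j m_{ij}\frac{f_j^{n+1}-f_j^n}{\tau_n}+\sum_j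 c_{ij}^nf_j^n+\sum_j d_{ij}^nf_j^n=0\quad\text{for all } i,\qquad n=0,\dots,N_T,$$ with $m_{ij}=(\psi_j,\psi_i)$, $c^n_{ij}=(\boldsymbol\beta_h^n\cdot\nabla\psi_j,\psi_i)$, $d^n_{ij}=(\boldsymbol{\mathsf A}^{L,n}\nabla\psi_j,\nabla\psi_i)$, and with time steps $\tau_n=t_{n+1}-t_n$ given by the CFL condition $$\tau_n=\lambda\,\frac{h_{\min}}{k\,\|\boldsymbol\beta_h^n\|_{L^\infty(\Omega)}},\qquad \lambda>0 .$$ **Claim.** There is a constant $C>0$ that depends only on $d_x,d_v,k$, the reference points $r_0,\dots,r_k$ and $\sigma$ (in particular not on the mesh size, on $\lambda$, on the number of time steps, on the fields or on the data) such that for every $m=0,1,\dots,N_T+1$ $$\|f_h^m\|^2+(1-\lambda C)\sum_{n=0}^{m-1}2\tau_n\,\big\|(\boldsymbol{\mathsf A}^{L,n})^{1/2}\nabla f_h^n\big\|^2\le\|f_0\|^2 .$$ In particular, if $\lambda C\le1$, then $\max_{0\le m\le N_T+1}\|f_h^m\|^2\le\|f_0\|^2$. -/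

import Mathlib

open MeasureTheory
open scoped Matrix

noncomputable section

namespace VlasovFE

/-- A mesh of a box in `ℝ^ι` into cuboids: in every coordinate direction `l` the interval
`[pt l 0, pt l M]` is cut by an arbitrary (not necessarily uniform) list of points into
`M = cells l` intervals, and the cells are the products of these intervals. For `ι = α ⊕ β` this is
the tensor product of a mesh in `ℝ^α` and a mesh in `ℝ^β`. -/
structure Mesh (ι : Type) where
  cells : ι → ℕ
  cells_pos : ∀ l, 0 < cells l
  pt : (l : ι) → Fin (cells l + 1) → ℝ
  pt_strictMono : ∀ l, StrictMono (pt l)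

/-- The phase-space coordinates: `Sum.inl l` stands for `x_l`, and `Sum.inr l` for `v_l`. -/
abbrev Coord (dx dv : ℕ) : Type := Fin dx ⊕ Fin dv

section

variable {ι : Type}

/-- The size in direction `l` of the cells that lie over the `c`-th interval. -/
def Mesh.width (T : Mesh ι) (l : ι) (c : Fin (T.cells l)) : ℝ :=
  T.pt l c.succ - T.pt l c.castSucc

/-- The box that is meshed, as a fundamental domain of the periodic box. -/
def Mesh.domain (T : Mesh ι) : Set (ι → ℝ) :=
  Set.univ.pi fun l => Set.Ico (T.pt l 0) (T.pt l (Fin.last _))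

/-- The smallest mesh size, over all directions and all cells. -/
def Mesh.hMin (T : Mesh ι) : ℝ :=
  ⨅ c : (Σ l, Fin (T.cells l)), T.width c.1 c.2

/-- The sizes in direction `l` of cells that are (periodically) adjacent in direction `l` differ at
most by the factor `σ`. Every uniform mesh is graded with `σ = 1`. -/
def Mesh.IsGraded (T : Mesh ι) (σ : ℝ) : Prop :=
  ∀ l c, T.width l (finRotate _ c) ≤ σ * T.width l c ∧ T.width l c ≤ σ * T.width l (finRotate _ c)

/-- Global Lagrange nodes of the periodic `Q_k` space. In each direction the node `(c, a)`, `a < k`,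
is the `a`-th Lagrange point of the `c`-th interval; the last (`k`-th) Lagrange point of an interval
is the point number `0` of the periodically next interval. -/
abbrev Node (T : Mesh ι) (k : ℕ) : Type := (l : ι) → Fin (T.cells l) × Fin k

/-- In one direction with `M` intervals: the `b`-th Lagrange point of the `c`-th interval is the
global (periodic) node `g`. -/
def IsNodeOf {M k : ℕ} (c : Fin M) (b : Fin (k + 1)) (g : Fin M × Fin k) : Prop :=
  (g.1 = c ∧ (g.2 : ℕ) = b) ∨ ((b : ℕ) = k ∧ g.1 = finRotate M c ∧ (g.2 : ℕ) = 0)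

open Classical in
/-- One-dimensional periodic continuous piecewise polynomial Lagrange basis function of the node
`g` in direction `l`; `r` are the Lagrange points of the reference interval `[0, 1]`. -/
def basis1D (T : Mesh ι) {k : ℕ} (r : Fin (k + 1) → ℝ) (l : ι) (g : Fin (T.cells l) × Fin k)
    (s : ℝ) : ℝ :=
  ∑ c : Fin (T.cells l),
    if T.pt l c.castSucc ≤ s ∧ s < T.pt l c.succ then
      ∑ b : Fin (k + 1),
        if IsNodeOf c b g then
          (Lagrange.basis Finset.univ r b).eval ((s - T.pt l c.castSucc) / T.width l c)
        else 0
    else 0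

/-- The classical partial derivative in direction `l`; for piecewise polynomials it exists off the
cell boundaries, that is, almost everywhere. -/
def pderiv [DecidableEq ι] (l : ι) (g : (ι → ℝ) → ℝ) (z : ι → ℝ) : ℝ :=
  deriv (fun s => g (Function.update z l s)) (z l)

variable [Fintype ι] [DecidableEq ι]

/-- The Lagrange basis functions `ψ_i` of the space `V`: products of one-dimensional ones. -/
def basis (T : Mesh ι) {k : ℕ} (r : Fin (k + 1) → ℝ) (i : Node T k) (z : ι → ℝ) : ℝ :=
  ∏ l, basis1D T r l (i l) (z l)

/-- The finite element function `∑_i u_i ψ_i` with the nodal values `u_i`. -/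
def feFun (T : Mesh ι) {k : ℕ} (r : Fin (k + 1) → ℝ) (u : Node T k → ℝ) (z : ι → ℝ) : ℝ :=
  ∑ i, u i * basis T r i z

/-- The `L²(Ω)` inner product. -/
def innerL2 (T : Mesh ι) (g w : (ι → ℝ) → ℝ) : ℝ := ∫ z in T.domain, g z * w z

/-- The squared `L²(Ω)` norm. -/
def normSqL2 (T : Mesh ι) (g : (ι → ℝ) → ℝ) : ℝ := ∫ z in T.domain, g z ^ 2

/-- The `L^∞(S)` norm (essential supremum) of a real function. -/
def normLinf (S : Set (ι → ℝ)) (g : (ι → ℝ) → ℝ) : ℝ :=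
  (eLpNorm g ⊤ (volume.restrict S)).toReal

/-- The `L^∞(Ω)` norm of a vector field, with the Euclidean norm of its values. -/
def vecNormLinf (T : Mesh ι) (β : (ι → ℝ) → ι → ℝ) : ℝ :=
  normLinf T.domain fun z => √(∑ l, β z l ^ 2)

/-- `δ l i` is an admissible value for the mesh size in direction `l` at the node `i`: it lies
between the smallest and the largest size in direction `l` of the cells that contain the node. If
the mesh is uniform in direction `l`, it is the common mesh size. -/
def IsNodalMeshSize (T : Mesh ι) {k : ℕ} (δ : ι → Node T k → ℝ) : Prop :=
  ∀ l i, (∃ c b, IsNodeOf c b (i l) ∧ T.width l c ≤ δ l i) ∧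
    (∃ c b, IsNodeOf c b (i l) ∧ δ l i ≤ T.width l c)

/-- The diagonal entry in direction `l` of the first-order viscosity matrix `A^L`: the finite element
function with the nodal values `(1/2) (Δz_l / k) ‖β_l‖_{L^∞(S(i))}`, `S(i)` the support of `ψ_i`. -/
def visc (T : Mesh ι) {k : ℕ} (r : Fin (k + 1) → ℝ) (δ : ι → Node T k → ℝ)
    (β : (ι → ℝ) → ι → ℝ) (l : ι) : (ι → ℝ) → ℝ :=
  feFun T r fun i =>
    1 / 2 * (δ l i / k) * normLinf (Function.support (basis T r i)) fun z => β z l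

/-- The mass matrix `m_ij = (ψ_j, ψ_i)`. -/
def massMat (T : Mesh ι) {k : ℕ} (r : Fin (k + 1) → ℝ) (i j : Node T k) : ℝ :=
  innerL2 T (basis T r j) (basis T r i)

/-- The advection matrix `c_ij = (β · ∇ψ_j, ψ_i)`. -/
def advMat (T : Mesh ι) {k : ℕ} (r : Fin (k + 1) → ℝ) (β : (ι → ℝ) → ι → ℝ)
    (i j : Node T k) : ℝ :=
  innerL2 T (fun z => ∑ l, β z l * pderiv l (basis T r j) z) (basis T r i)

/-- The diffusion matrix `d_ij = (A ∇ψ_j, ∇ψ_i)` for the diagonal matrix field `A = diag(a_l)`. -/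
def diffMat (T : Mesh ι) {k : ℕ} (r : Fin (k + 1) → ℝ) (a : ι → (ι → ℝ) → ℝ)
    (i j : Node T k) : ℝ :=
  ∫ z in T.domain, ∑ l, a l z * pderiv l (basis T r j) z * pderiv l (basis T r i) z

/-- One step, of length `τ`, of the forward Euler scheme from the nodal values `u` to `u'`. -/
def EulerStep (T : Mesh ι) {k : ℕ} (r : Fin (k + 1) → ℝ) (β : (ι → ℝ) → ι → ℝ)
    (a : ι → (ι → ℝ) → ℝ) (τ : ℝ) (u u' : Node T k → ℝ) : Prop :=
  ∀ i, ∑ j, massMat T r i j * ((u' j - u j) / τ) + ∑ j, advMat T r β i j * u j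
    + ∑ j, diffMat T r a i j * u j = 0

/-- `‖A^{1/2} ∇g‖²` for the diagonal matrix field `A = diag(a_l)`. -/
def dissipation (T : Mesh ι) (a : ι → (ι → ℝ) → ℝ) (g : (ι → ℝ) → ℝ) : ℝ :=
  ∫ z in T.domain, ∑ l, (√(a l z) * pderiv l g z) ^ 2

end

/-- The velocity as a vector of `ℝ³`; in reduced models the missing components are `0`. -/
def velocity {dx dv : ℕ} (z : Coord dx dv → ℝ) (a : Fin 3) : ℝ :=
  if h : (a : ℕ) < dv then z (Sum.inr ⟨a, h⟩) else 0

/-- The phase-space advection field `β = (v, E(x) + v × B(x))`, restricted to the `dx` position and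
`dv` velocity components that are present in the model. -/
def advection {dx dv : ℕ} (hx : dx ≤ dv) (hv : dv ≤ 3) (E B : (Fin dx → ℝ) → Fin 3 → ℝ)
    (z : Coord dx dv → ℝ) : Coord dx dv → ℝ
  | Sum.inl l => z (Sum.inr (Fin.castLE hx l))
  | Sum.inr l =>
      (E (fun j => z (Sum.inl j)) + velocity z ⨯₃ B (fun j => z (Sum.inl j))) (Fin.castLE hv l)

/-- The spatial box `Ω_x` of a phase-space mesh. -/
def Mesh.spatialDomain {dx dv : ℕ} (T : Mesh (Coord dx dv)) : Set (Fin dx → ℝ) :=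
  Set.univ.pi fun l => Set.Ico (T.pt (Sum.inl l) 0) (T.pt (Sum.inl l) (Fin.last _))

end VlasovFE

end

open VlasovFE

/-!
The increment `w = f_h^{n+1} - f_h^n` decides whether a forward Euler step is stable. Testing the scheme
with `f_h^n` annihilates the advection term, because every component of `β` is independent of its own
coordinate and the finite element functions are periodic (`integral_advection_eq_zero`). With `D` the
dissipation this gives `‖f_h^{n+1}‖² = ‖f_h^n‖² - 2 τ D + ‖w‖²`, and it remains to bound `‖w‖²` by a
multiple of `λ τ D`. Testing with `w` and Young's inequality (`EulerStep.normSqL2_le`) reduce this to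
two estimates, in which the constants do not depend on the mesh:

* `‖β · ∇f‖² ≤ C (‖β‖_∞ / h_min) D` (`exists_integral_advection_sq_le`);
* `‖A^{1/2} ∇w‖² ≤ C (‖β‖_∞ / h_min) ‖w‖²` (`exists_integral_viscosity_le`), an inverse estimate.

The CFL condition turns `τ ‖β‖_∞ / h_min` into `λ / k`.

In the first estimate the viscosity `ε_l` is bounded below at the nodes only, by
`h_min ‖β_l‖_∞ / (2 k)` with the supremum over the cell; for `k ≥ 2` it is nonnegative but may vanish
inside a cell, so that `β_l² ≤ C (‖β‖_∞ / h_min) ε_l` can fail pointwise. It holds in the mean, against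
squares of polynomials: on the reference cube `∫ q p² ≥ c ‖q‖ ‖p‖²` for all `p` in `Q_k` and all
nonnegative `q` in `Q_k`, by compactness of the unit spheres, since a product of nonzero polynomials does
not vanish almost everywhere (`exists_weighted_lower_bound`). With `q = 1` the same bound yields the
inverse estimate (`exists_inverse_estimate`), and both are moved to the cells by scaling.
-/

/-! ### Tensor-product polynomials on the reference cube -/

namespace VlasovFE

open Polynomial in
/-- The function `s ↦ ∑_j a_j ∏_l P_{l, j_l}(s_l)` for families `P_l` of univariate polynomials. If
every `P_l` is the Lagrange basis, this is the element of `Q_k` with the nodal values `a`. -/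
noncomputable def tensorPoly {ι : Type} [Fintype ι] [DecidableEq ι] {k : ℕ}
    (P : ι → Fin (k + 1) → ℝ[X])
    (a : (ι → Fin (k + 1)) → ℝ) (s : ι → ℝ) : ℝ :=
  ∑ j, a j * ∏ l, (P l (j l)).eval (s l)

/-- The half-open unit cube. -/
def refCube (ι : Type) : Set (ι → ℝ) := Set.univ.pi fun _ => Set.Ico 0 1

/-- The Lagrange basis polynomials of the points `r`, in every direction. -/
noncomputable def lagrangeFamily (ι : Type) {k : ℕ} (r : Fin (k + 1) → ℝ) :
    ι → Fin (k + 1) → Polynomial ℝ :=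
  fun _ b => Lagrange.basis Finset.univ r b

theorem measurableSet_refCube {ι : Type} [Fintype ι] : MeasurableSet (refCube ι) :=
  MeasurableSet.univ_pi fun _ => measurableSet_Ico

theorem refCube_ae_eq {ι : Type} [Fintype ι] : refCube ι =ᵐ[volume] Set.Icc (0 : ι → ℝ) 1 :=
  Measure.univ_pi_Ico_ae_eq_Icc

theorem refCube_subset_Icc {ι : Type} : refCube ι ⊆ Set.Icc (0 : ι → ℝ) 1 := fun _ hs =>
  ⟨fun l => (hs l trivial).1, fun l => (hs l trivial).2.le⟩

theorem volume_real_refCube {ι : Type} [Fintype ι] : volume.real (refCube ι) = 1 := by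
  rw [refCube, measureReal_def, volume_pi_pi]
  simp

theorem integrableOn_refCube {ι : Type} [Fintype ι] {g : (ι → ℝ) → ℝ} (hg : Continuous g) :
    IntegrableOn g (refCube ι) :=
  (hg.continuousOn.integrableOn_compact isCompact_Icc).mono_set refCube_subset_Icc

section

variable {ι : Type} [Fintype ι] [DecidableEq ι] {k : ℕ}

theorem continuous_uncurry_tensorPoly (P : ι → Fin (k + 1) → Polynomial ℝ) :
    Continuous (Function.uncurry (tensorPoly P)) := by
  unfold tensorPoly Function.uncurry
  fun_prop

theorem continuous_tensorPoly (P : ι → Fin (k + 1) → Polynomial ℝ) (a : (ι → Fin (k + 1)) → ℝ) :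
    Continuous (tensorPoly P a) :=
  (continuous_uncurry_tensorPoly P).comp (by fun_prop : Continuous fun s => (a, s))

theorem tensorPoly_smul (P : ι → Fin (k + 1) → Polynomial ℝ) (c : ℝ)
    (a : (ι → Fin (k + 1)) → ℝ) (s : ι → ℝ) :
    tensorPoly P (c • a) s = c * tensorPoly P a s := by
  simp [tensorPoly, Finset.mul_sum, mul_assoc]

/-- The coefficients of a tensor-product Lagrange polynomial are its nodal values. -/
theorem tensorPoly_lagrange_node {r : Fin (k + 1) → ℝ} (hr : Function.Injective r)
    (a : (ι → Fin (k + 1)) → ℝ) (j : ι → Fin (k + 1)) :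
    tensorPoly (lagrangeFamily ι r) a (fun l => r (j l)) = a j := by
  unfold tensorPoly lagrangeFamily
  rw [Finset.sum_eq_single j]
  · simp [Lagrange.eval_basis_self hr.injOn]
  · intro j' _ hj
    obtain ⟨l, hl⟩ := Function.ne_iff.1 hj
    rw [Finset.prod_eq_zero (Finset.mem_univ l), mul_zero]
    exact Lagrange.eval_basis_of_ne hl (Finset.mem_univ _)
  · simp

theorem exists_mvPolynomial (P : ι → Fin (k + 1) → Polynomial ℝ) (a : (ι → Fin (k + 1)) → ℝ) :
    ∃ Q : MvPolynomial ι ℝ, ∀ s, MvPolynomial.eval s Q = tensorPoly P a s :=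
  ⟨∑ j, MvPolynomial.C (a j) * ∏ l, (P l (j l)).toMvPolynomial l, fun s => by
    simp [tensorPoly, MvPolynomial.eval_toMvPolynomial]⟩

/-- The integral is zero only if the polynomial `q_a * q_b ^ 2` vanishes on the cube, which forces
one of its factors to be the zero polynomial. -/
theorem integral_weighted_sq_pos {r : Fin (k + 1) → ℝ} (hr : Function.Injective r)
    {a b : (ι → Fin (k + 1)) → ℝ} (ha : ∀ s ∈ refCube ι, 0 ≤ tensorPoly (lagrangeFamily ι r) a s)
    (ha0 : a ≠ 0) (hb0 : b ≠ 0) :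
    0 < ∫ s in refCube ι,
      tensorPoly (lagrangeFamily ι r) a s * tensorPoly (lagrangeFamily ι r) b s ^ 2 := by
  set L := lagrangeFamily ι r
  have hcont : Continuous fun s => tensorPoly L a s * tensorPoly L b s ^ 2 :=
    (continuous_tensorPoly L a).mul ((continuous_tensorPoly L b).pow 2)
  have hnn : 0 ≤ᵐ[volume.restrict (refCube ι)] fun s => tensorPoly L a s * tensorPoly L b s ^ 2 :=
    (ae_restrict_mem measurableSet_refCube).mono fun s hs => mul_nonneg (ha s hs) (sq_nonneg _)
  refine lt_of_le_of_ne (integral_nonneg_of_ae hnn) fun h => ?_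
  have hz := (setIntegral_eq_zero_iff_of_nonneg_ae hnn (integrableOn_refCube hcont)).1 h.symm
  have hsub : (Set.univ.pi fun _ => Set.Ioo 0 1 : Set (ι → ℝ)) ⊆ refCube ι :=
    Set.pi_mono fun _ _ => Set.Ioo_subset_Ico_self
  have hz' := Measure.eqOn_open_of_ae_eq (ae_restrict_of_ae_restrict_of_subset hsub hz)
    (isOpen_set_pi Set.finite_univ fun _ _ => isOpen_Ioo) hcont.continuousOn
    continuousOn_const
  obtain ⟨Qa, hQa⟩ := exists_mvPolynomial L a
  obtain ⟨Qb, hQb⟩ := exists_mvPolynomial L b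
  have hQ : Qa * Qb ^ 2 = 0 := by
    refine MvPolynomial.funext_set (fun _ => Set.Ioo 0 1)
      (fun _ => Set.Ioo_infinite zero_lt_one) fun s hs => ?_
    simpa [hQa, hQb] using hz' hs
  rcases mul_eq_zero.1 hQ with h | h
  · exact ha0 (funext fun j => by rw [← tensorPoly_lagrange_node hr a j, ← hQa, h]; simp)
  · have h := pow_eq_zero_iff (two_ne_zero) |>.1 h
    exact hb0 (funext fun j => by rw [← tensorPoly_lagrange_node hr b j, ← hQb, h]; simp)

/-- A nonnegative weight in `Q_k` may vanish somewhere, but weighted `L²` norms on `Q_k` are still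
bounded below by the size of its nodal values, uniformly: this is compactness of the unit spheres of
the nodal value spaces. -/
theorem exists_weighted_lower_bound {r : Fin (k + 1) → ℝ} (hr : Function.Injective r) :
    ∃ c > 0, ∀ a : (ι → Fin (k + 1)) → ℝ,
      (∀ s ∈ refCube ι, 0 ≤ tensorPoly (lagrangeFamily ι r) a s) → ∀ b : (ι → Fin (k + 1)) → ℝ,
      c * ‖a‖ * ‖b‖ ^ 2 ≤ ∫ s in refCube ι,
        tensorPoly (lagrangeFamily ι r) a s * tensorPoly (lagrangeFamily ι r) b s ^ 2 := by
  set L := lagrangeFamily ι r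
  set W := (ι → Fin (k + 1)) → ℝ
  let S : Set W := {a | ∀ s ∈ refCube ι, 0 ≤ tensorPoly L a s}
  have hS : IsClosed S := by
    have : S = ⋂ s ∈ refCube ι, {a | 0 ≤ tensorPoly L a s} := by
      ext; simp only [S, Set.mem_iInter]; rfl
    rw [this]
    refine isClosed_biInter fun s _ => isClosed_le continuous_const ?_
    exact (continuous_uncurry_tensorPoly L).comp (by fun_prop : Continuous fun a => (a, s))
  let F : W × W → ℝ := fun p =>
    ∫ s in refCube ι, tensorPoly L p.1 s * tensorPoly L p.2 s ^ 2
  have hF : Continuous F := by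
    have h : Continuous fun p : W × W =>
        ∫ s in Set.Icc (0 : ι → ℝ) 1, tensorPoly L p.1 s * tensorPoly L p.2 s ^ 2 := by
      refine continuous_parametric_integral_of_continuous ?_ isCompact_Icc
      have h1 : Continuous fun q : (W × W) × (ι → ℝ) => tensorPoly L q.1.1 q.2 :=
        (continuous_uncurry_tensorPoly L).comp
          (by fun_prop : Continuous fun q : (W × W) × (ι → ℝ) => (q.1.1, q.2))
      have h2 : Continuous fun q : (W × W) × (ι → ℝ) => tensorPoly L q.1.2 q.2 :=
        (continuous_uncurry_tensorPoly L).comp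
          (by fun_prop : Continuous fun q : (W × W) × (ι → ℝ) => (q.1.2, q.2))
      exact h1.mul (h2.pow 2)
    convert h using 2 with p
    exact setIntegral_congr_set refCube_ae_eq
  let K : Set (W × W) := (Metric.sphere 0 1 ∩ S) ×ˢ Metric.sphere 0 1
  have hK : IsCompact K := ((isCompact_sphere 0 1).inter_right hS).prod (isCompact_sphere 0 1)
  have hne : ∀ {a : W}, a ∈ Metric.sphere (0 : W) 1 → a ≠ 0 := fun h h0 => by
    simp [h0] at h
  obtain ⟨c, hc, hmin⟩ : ∃ c > 0, ∀ p ∈ K, c ≤ F p := by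
    rcases K.eq_empty_or_nonempty with h | h
    · exact ⟨1, one_pos, by simp [h]⟩
    · obtain ⟨p, hp, hmin⟩ := hK.exists_isMinOn h hF.continuousOn
      exact ⟨F p, integral_weighted_sq_pos hr hp.1.2 (hne hp.1.1) (hne hp.2), fun q hq => hmin hq⟩
  refine ⟨c, hc, fun a ha b => ?_⟩
  rcases eq_or_ne a 0 with rfl | ha0
  · simp [tensorPoly]
  rcases eq_or_ne b 0 with rfl | hb0
  · simp [tensorPoly]
  have hna := norm_pos_iff.2 ha0
  have hnb := norm_pos_iff.2 hb0
  have h := hmin (‖a‖⁻¹ • a, ‖b‖⁻¹ • b)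
    ⟨⟨by simp [norm_smul, hna.ne'], fun s hs => by
      rw [tensorPoly_smul]; exact mul_nonneg (by positivity) (ha s hs)⟩,
      by simp [norm_smul, hnb.ne']⟩
  have hFe : F (‖a‖⁻¹ • a, ‖b‖⁻¹ • b) = ‖a‖⁻¹ * (‖b‖⁻¹) ^ 2 * F (a, b) := by
    simp only [F, tensorPoly_smul]
    rw [← integral_const_mul]
    congr 1; ext s; ring
  rw [hFe] at h
  calc c * ‖a‖ * ‖b‖ ^ 2 ≤ (‖a‖⁻¹ * (‖b‖⁻¹) ^ 2 * F (a, b)) * ‖a‖ * ‖b‖ ^ 2 := by gcongr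
    _ = F (a, b) := by field_simp

theorem exists_tensorPoly_bound (P : ι → Fin (k + 1) → Polynomial ℝ) :
    ∃ Λ > 0, ∀ a : (ι → Fin (k + 1)) → ℝ, ∀ s ∈ refCube ι, |tensorPoly P a s| ≤ Λ * ‖a‖ := by
  have h : ∀ j : ι → Fin (k + 1), ∃ C : ℝ, ∀ s ∈ refCube ι, |∏ l, (P l (j l)).eval (s l)| ≤ C := by
    intro j
    have hc : ContinuousOn (fun s : ι → ℝ => ∏ l, (P l (j l)).eval (s l))
        (Set.Icc (0 : ι → ℝ) 1) := by fun_prop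
    obtain ⟨C, hC⟩ := isCompact_Icc.exists_bound_of_continuousOn hc
    exact ⟨C, fun s hs => hC s (refCube_subset_Icc hs)⟩
  choose C hC using h
  refine ⟨∑ j, |C j| + 1, by positivity, fun a s hs => ?_⟩
  calc |tensorPoly P a s| ≤ ∑ j, |a j * ∏ l, (P l (j l)).eval (s l)| :=
        Finset.abs_sum_le_sum_abs _ _
    _ ≤ ∑ j, ‖a‖ * |C j| := Finset.sum_le_sum fun j _ => by
        rw [abs_mul]
        exact mul_le_mul (norm_le_pi_norm a j) ((hC j s hs).trans (le_abs_self _))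
          (abs_nonneg _) (norm_nonneg _)
    _ ≤ (∑ j, |C j| + 1) * ‖a‖ := by
        rw [← Finset.mul_sum, mul_comm]
        gcongr
        linarith

/-- Tensor products of polynomials of degree at most `k` lie in `Q_k`: interpolate them. -/
theorem exists_tensorPoly_eq_lagrange {r : Fin (k + 1) → ℝ} (hr : Function.Injective r)
    {P : ι → Fin (k + 1) → Polynomial ℝ} (hP : ∀ l b, (P l b).degree < (k + 1 : ℕ))
    (b : (ι → Fin (k + 1)) → ℝ) :
    ∃ b', ∀ s, tensorPoly P b s = tensorPoly (lagrangeFamily ι r) b' s := by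
  have hP' : ∀ l m x, (P l m).eval x =
      ∑ n, (P l m).eval (r n) * (Lagrange.basis Finset.univ r n).eval x := by
    intro l m x
    conv_lhs => rw [Lagrange.eq_interpolate (s := Finset.univ) (v := r) (f := P l m) hr.injOn
      (by simpa using hP l m), Lagrange.interpolate_apply]
    simp [Polynomial.eval_finsetSum]
  refine ⟨fun i => ∑ j, b j * ∏ l, (P l (j l)).eval (r (i l)), fun s => ?_⟩
  unfold tensorPoly lagrangeFamily
  simp_rw [Finset.sum_mul]
  rw [Finset.sum_comm]
  refine Finset.sum_congr rfl fun j _ => ?_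
  simp_rw [mul_assoc, ← Finset.mul_sum, ← Finset.prod_mul_distrib]
  rw [Finset.prod_congr rfl fun l _ => hP' l (j l) (s l), Finset.prod_univ_sum,
    Fintype.piFinset_univ]

theorem integral_tensorPoly_sq_le {P : ι → Fin (k + 1) → Polynomial ℝ} {Λ : ℝ}
    {a : (ι → Fin (k + 1)) → ℝ}
    (h : ∀ s ∈ refCube ι, |tensorPoly P a s| ≤ Λ * ‖a‖) :
    ∫ s in refCube ι, tensorPoly P a s ^ 2 ≤ Λ ^ 2 * ‖a‖ ^ 2 := by
  have := setIntegral_mono_on (μ := volume) (s := refCube ι)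
    (f := fun s => tensorPoly P a s ^ 2) (g := fun _ => Λ ^ 2 * ‖a‖ ^ 2)
    (integrableOn_refCube ((continuous_tensorPoly P a).pow 2))
    (integrableOn_refCube continuous_const) measurableSet_refCube
    fun s hs => by
      rw [← sq_abs (tensorPoly P a s), ← mul_pow]
      exact pow_le_pow_left₀ (abs_nonneg _) (h s hs) 2
  simpa [volume_real_refCube] using this

/-- The lower bound for weighted norms in terms of `L²` norms, for polynomials in the span of other
families of degree at most `k`; the derivatives are of this kind. -/
theorem exists_weighted_norm_equiv {r : Fin (k + 1) → ℝ} (hr : Function.Injective r)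
    {P : ι → Fin (k + 1) → Polynomial ℝ} (hP : ∀ l b, (P l b).degree < (k + 1 : ℕ)) :
    ∃ C > 0, ∀ a : (ι → Fin (k + 1)) → ℝ,
      (∀ s ∈ refCube ι, 0 ≤ tensorPoly (lagrangeFamily ι r) a s) → ∀ b : (ι → Fin (k + 1)) → ℝ,
      ‖a‖ * ∫ s in refCube ι, tensorPoly P b s ^ 2 ≤ C * ∫ s in refCube ι,
        tensorPoly (lagrangeFamily ι r) a s * tensorPoly P b s ^ 2 := by
  obtain ⟨c, hc, hlow⟩ := exists_weighted_lower_bound (ι := ι) hr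
  obtain ⟨Λ, hΛ, hup⟩ := exists_tensorPoly_bound (lagrangeFamily ι r)
  refine ⟨Λ ^ 2 / c, by positivity, fun a ha b => ?_⟩
  obtain ⟨b', hb'⟩ := exists_tensorPoly_eq_lagrange hr hP b
  simp_rw [hb']
  calc _ ≤ ‖a‖ * (Λ ^ 2 * ‖b'‖ ^ 2) := by
        gcongr
        exact integral_tensorPoly_sq_le (hup b')
    _ = Λ ^ 2 / c * (c * ‖a‖ * ‖b'‖ ^ 2) := by field_simp
    _ ≤ _ := by gcongr; exact hlow a ha b'

theorem exists_inverse_estimate {r : Fin (k + 1) → ℝ} (hr : Function.Injective r)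
    (P : ι → Fin (k + 1) → Polynomial ℝ) :
    ∃ C > 0, ∀ b : (ι → Fin (k + 1)) → ℝ,
      ∫ s in refCube ι, tensorPoly P b s ^ 2 ≤
        C * ∫ s in refCube ι, tensorPoly (lagrangeFamily ι r) b s ^ 2 := by
  obtain ⟨c, hc, hlow⟩ := exists_weighted_lower_bound (ι := ι) hr
  obtain ⟨Λ, hΛ, hup⟩ := exists_tensorPoly_bound P
  have hone : ∀ s : ι → ℝ, tensorPoly (lagrangeFamily ι r) 1 s = 1 := by
    intro s
    have h1 : ∀ l : ι, ∑ n, (lagrangeFamily ι r l n).eval (s l) = 1 := fun l => by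
      have := congrArg (Polynomial.eval (s l))
        (Lagrange.sum_basis (s := Finset.univ) (v := r) hr.injOn ⟨0, Finset.mem_univ _⟩)
      simpa [Polynomial.eval_finsetSum, lagrangeFamily] using this
    have := Finset.prod_univ_sum (fun _ : ι => (Finset.univ : Finset (Fin (k + 1))))
      (fun l n => (lagrangeFamily ι r l n).eval (s l))
    rw [Fintype.piFinset_univ, Finset.prod_congr rfl fun l _ => h1 l] at this
    simpa [tensorPoly] using this.symm
  have h1 : ‖(1 : (ι → Fin (k + 1)) → ℝ)‖ = 1 := by simp
  refine ⟨Λ ^ 2 / c, by positivity, fun b => ?_⟩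
  calc _ ≤ Λ ^ 2 * ‖b‖ ^ 2 := integral_tensorPoly_sq_le (hup b)
    _ = Λ ^ 2 / c * (c * ‖(1 : (ι → Fin (k + 1)) → ℝ)‖ * ‖b‖ ^ 2) := by rw [h1]; field_simp
    _ ≤ _ := by
      gcongr
      simpa [hone] using hlow 1 (fun s _ => by simp [hone]) b

end

end VlasovFE

/-! ### Periodic piecewise polynomials of one variable -/

namespace VlasovFE

section

variable {ι : Type}

theorem Mesh.width_pos (T : Mesh ι) (l : ι) (c : Fin (T.cells l)) : 0 < T.width l c :=
  sub_pos.2 (T.pt_strictMono l Fin.castSucc_lt_succ)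

/-- The `c`-th interval in direction `l`. -/
def Mesh.interval (T : Mesh ι) (l : ι) (c : Fin (T.cells l)) : Set ℝ :=
  Set.Ico (T.pt l c.castSucc) (T.pt l c.succ)

/-- The affine coordinate of the `c`-th interval in direction `l`, with values in `[0, 1)` there. -/
noncomputable def Mesh.localCoord (T : Mesh ι) (l : ι) (c : Fin (T.cells l)) (s : ℝ) : ℝ :=
  (s - T.pt l c.castSucc) / T.width l c

theorem Mesh.measurableSet_interval (T : Mesh ι) (l : ι) (c : Fin (T.cells l)) :
    MeasurableSet (T.interval l c) := measurableSet_Ico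

theorem Mesh.interval_inj (T : Mesh ι) {l : ι} {c c' : Fin (T.cells l)} {s : ℝ}
    (h : s ∈ T.interval l c) (h' : s ∈ T.interval l c') : c = c' := by
  have key : ∀ {c c' : Fin (T.cells l)}, s ∈ T.interval l c → s ∈ T.interval l c' → c ≤ c' := by
    intro c c' h h'
    have := (T.pt_strictMono l).lt_iff_lt.1 (h.1.trans_lt h'.2)
    exact Fin.castSucc_lt_succ_iff.1 this
  exact le_antisymm (key h h') (key h' h)

theorem Mesh.exists_mem_interval (T : Mesh ι) {l : ι} {s : ℝ}
    (hs : s ∈ Set.Ico (T.pt l 0) (T.pt l (Fin.last _))) : ∃ c, s ∈ T.interval l c := by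
  by_contra! h
  have : ∀ i, T.pt l i ≤ s := by
    intro i
    induction i using Fin.induction with
    | zero => exact hs.1
    | succ c ih => exact not_lt.1 fun hlt => h c ⟨ih, hlt⟩
  exact absurd (this (Fin.last _)) (not_le.2 hs.2)

theorem Mesh.interval_subset (T : Mesh ι) (l : ι) (c : Fin (T.cells l)) :
    T.interval l c ⊆ Set.Ico (T.pt l 0) (T.pt l (Fin.last _)) :=
  Set.Ico_subset_Ico ((T.pt_strictMono l).monotone (Fin.zero_le _))
    ((T.pt_strictMono l).monotone (Fin.le_last _))

/-- The function that equals `p c`, in the local coordinate, on the `c`-th interval in direction `l`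
and vanishes outside the mesh. -/
noncomputable def piecewisePoly (T : Mesh ι) (l : ι) (p : Fin (T.cells l) → Polynomial ℝ)
    (s : ℝ) : ℝ :=
  ∑ c, (T.interval l c).indicator (fun s => (p c).eval (T.localCoord l c s)) s

theorem piecewisePoly_of_mem (T : Mesh ι) {l : ι} (p : Fin (T.cells l) → Polynomial ℝ)
    {c : Fin (T.cells l)} {s : ℝ} (h : s ∈ T.interval l c) :
    piecewisePoly T l p s = (p c).eval (T.localCoord l c s) := by
  unfold piecewisePoly
  rw [Finset.sum_eq_single c, Set.indicator_of_mem h]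
  · exact fun c' _ hc => Set.indicator_of_notMem (fun h' => hc (T.interval_inj h' h)) _
  · simp

theorem piecewisePoly_of_notMem (T : Mesh ι) {l : ι} (p : Fin (T.cells l) → Polynomial ℝ)
    {s : ℝ} (h : s ∉ Set.Ico (T.pt l 0) (T.pt l (Fin.last _))) : piecewisePoly T l p s = 0 :=
  Finset.sum_eq_zero fun c _ => Set.indicator_of_notMem (fun h' => h (T.interval_subset l c h')) _

theorem continuous_eval_localCoord (T : Mesh ι) (l : ι) (c : Fin (T.cells l)) (p : Polynomial ℝ) :
    Continuous fun s => p.eval (T.localCoord l c s) := by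
  unfold Mesh.localCoord
  fun_prop

theorem measurable_piecewisePoly (T : Mesh ι) (l : ι) (p : Fin (T.cells l) → Polynomial ℝ) :
    Measurable (piecewisePoly T l p) :=
  Finset.measurable_sum _ fun c _ =>
    (continuous_eval_localCoord T l c (p c)).measurable.indicator measurableSet_Ico

theorem exists_piecewisePoly_bound (T : Mesh ι) (l : ι) (p : Fin (T.cells l) → Polynomial ℝ) :
    ∃ R, ∀ s, |piecewisePoly T l p s| ≤ R := by
  have h : ∀ c, ∃ R, ∀ s ∈ T.interval l c, |(p c).eval (T.localCoord l c s)| ≤ R := fun c => by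
    obtain ⟨R, hR⟩ := (isCompact_Icc (a := T.pt l c.castSucc)
      (b := T.pt l c.succ)).exists_bound_of_continuousOn (continuous_eval_localCoord T l c (p c)).continuousOn
    exact ⟨R, fun s hs => hR s (Set.Ico_subset_Icc_self hs)⟩
  choose R hR using h
  refine ⟨∑ c, |R c|, fun s => ?_⟩
  by_cases hs : s ∈ Set.Ico (T.pt l 0) (T.pt l (Fin.last _))
  · obtain ⟨c, hc⟩ := T.exists_mem_interval hs
    rw [piecewisePoly_of_mem T p hc]
    exact (hR c s hc).trans ((le_abs_self _).trans
      (Finset.single_le_sum (f := fun c => |R c|) (fun c _ => abs_nonneg _) (Finset.mem_univ c)))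
  · rw [piecewisePoly_of_notMem T p hs, abs_zero]
    positivity

theorem piecewisePoly_sum (T : Mesh ι) (l : ι) {κ : Type*} (S : Finset κ) (w : κ → ℝ)
    (p : κ → Fin (T.cells l) → Polynomial ℝ) (s : ℝ) :
    ∑ i ∈ S, w i * piecewisePoly T l (p i) s =
      piecewisePoly T l (fun c => ∑ i ∈ S, Polynomial.C (w i) * p i c) s := by
  by_cases hs : s ∈ Set.Ico (T.pt l 0) (T.pt l (Fin.last _))
  · obtain ⟨c, hc⟩ := T.exists_mem_interval hs
    simp [piecewisePoly_of_mem T _ hc, Polynomial.eval_finsetSum]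
  · simp [piecewisePoly_of_notMem T _ hs]

/-- The pieces of the derivative of the piecewise polynomial with the pieces `p c`; the factor comes
from the scaling of the local coordinate. -/
noncomputable def derivPieces (T : Mesh ι) (l : ι) (p : Fin (T.cells l) → Polynomial ℝ)
    (c : Fin (T.cells l)) : Polynomial ℝ :=
  Polynomial.C (T.width l c)⁻¹ * (p c).derivative

theorem hasDerivAt_eval_localCoord (T : Mesh ι) (l : ι) (p : Fin (T.cells l) → Polynomial ℝ)
    (c : Fin (T.cells l)) (s : ℝ) :
    HasDerivAt (fun s => (p c).eval (T.localCoord l c s))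
      ((derivPieces T l p c).eval (T.localCoord l c s)) s := by
  have h : HasDerivAt (T.localCoord l c) (1 / T.width l c) s :=
    ((hasDerivAt_id s).sub_const _).div_const _
  refine (((p c).hasDerivAt (T.localCoord l c s)).comp s h).congr_deriv ?_
  simp [derivPieces, mul_comm]

theorem hasDerivAt_piecewisePoly (T : Mesh ι) {l : ι} (p : Fin (T.cells l) → Polynomial ℝ)
    {s : ℝ} (hs : s ∈ Set.Ico (T.pt l 0) (T.pt l (Fin.last _))) (hne : ∀ i, s ≠ T.pt l i) :
    HasDerivAt (piecewisePoly T l p) (piecewisePoly T l (derivPieces T l p) s) s := by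
  obtain ⟨c, hc⟩ := T.exists_mem_interval hs
  rw [piecewisePoly_of_mem T _ hc]
  refine (hasDerivAt_eval_localCoord T l p c s).congr_of_eventuallyEq ?_
  filter_upwards [Ioo_mem_nhds (lt_of_le_of_ne hc.1 (hne _).symm) hc.2] with x hx
  exact piecewisePoly_of_mem T p ⟨hx.1.le, hx.2⟩

/-- On each interval the integral of `F F'` is half the increment of `F²`; the increments cancel
around the circle. -/
theorem integral_piecewisePoly_mul_deriv (T : Mesh ι) (l : ι) (p : Fin (T.cells l) → Polynomial ℝ)
    (hp : ∀ c, (p c).eval 1 = (p (finRotate _ c)).eval 0) :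
    ∫ s, piecewisePoly T l p s * piecewisePoly T l (derivPieces T l p) s = 0 := by
  have heq : ∀ s, piecewisePoly T l p s * piecewisePoly T l (derivPieces T l p) s =
      ∑ c, (T.interval l c).indicator (fun s => (p c).eval (T.localCoord l c s) *
        (derivPieces T l p c).eval (T.localCoord l c s)) s := by
    intro s
    by_cases hs : s ∈ Set.Ico (T.pt l 0) (T.pt l (Fin.last _))
    · obtain ⟨c, hc⟩ := T.exists_mem_interval hs
      rw [piecewisePoly_of_mem T _ hc, piecewisePoly_of_mem T _ hc, Finset.sum_eq_single c,
        Set.indicator_of_mem hc]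
      · exact fun c' _ hne => Set.indicator_of_notMem (fun h' => hne (T.interval_inj h' hc)) _
      · simp
    · rw [piecewisePoly_of_notMem T _ hs, zero_mul, Finset.sum_eq_zero]
      exact fun c _ => Set.indicator_of_notMem (fun h' => hs (T.interval_subset l c h')) _
  have hcont : ∀ c, Continuous fun s => (p c).eval (T.localCoord l c s) *
        (derivPieces T l p c).eval (T.localCoord l c s) := fun c =>
    (continuous_eval_localCoord T l c _).mul (continuous_eval_localCoord T l c _)
  have hcell : ∀ c, ∫ s in T.interval l c, (p c).eval (T.localCoord l c s) *
        (derivPieces T l p c).eval (T.localCoord l c s) =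
      (p (finRotate _ c)).eval 0 ^ 2 / 2 - (p c).eval 0 ^ 2 / 2 := by
    intro c
    have hlt : T.pt l c.castSucc ≤ T.pt l c.succ := (sub_pos.1 (T.width_pos l c)).le
    rw [Mesh.interval, integral_Ico_eq_integral_Ioc, ← intervalIntegral.integral_of_le hlt,
      intervalIntegral.integral_eq_sub_of_hasDerivAt
        (f := fun s => (p c).eval (T.localCoord l c s) ^ 2 / 2)
        (fun s _ => by
          refine (((hasDerivAt_eval_localCoord T l p c s).pow 2).div_const 2).congr_deriv ?_
          push_cast
          ring) ((hcont c).intervalIntegrable _ _)]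
    have h1 : T.localCoord l c (T.pt l c.succ) = 1 := div_self (T.width_pos l c).ne'
    have h0 : T.localCoord l c (T.pt l c.castSucc) = 0 := by simp [Mesh.localCoord]
    simp only [h1, h0, hp]
  simp_rw [heq]
  rw [integral_finsetSum]
  · rw [Finset.sum_congr rfl fun c _ =>
      (integral_indicator (T.measurableSet_interval l c)).trans (hcell c)]
    rw [Finset.sum_sub_distrib,
      Equiv.sum_comp (finRotate _) fun c => (p c).eval 0 ^ 2 / 2, sub_self]
  · intro c _
    rw [integrable_indicator_iff (T.measurableSet_interval l c)]
    exact ((hcont c).continuousOn.integrableOn_compact isCompact_Icc).mono_set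
      Set.Ico_subset_Icc_self

end

/-! ### The Lagrange basis on one interval -/

section

/-- The global node that is the `b`-th Lagrange point of the `c`-th interval. -/
def localNode {M k : ℕ} (hk : 0 < k) (c : Fin M) (b : Fin (k + 1)) : Fin M × Fin k :=
  if h : (b : ℕ) < k then (c, ⟨b, h⟩) else (finRotate M c, ⟨0, hk⟩)

theorem isNodeOf_iff {M k : ℕ} (hk : 0 < k) {c : Fin M} {b : Fin (k + 1)} {g : Fin M × Fin k} :
    IsNodeOf c b g ↔ g = localNode hk c b := by
  unfold IsNodeOf localNode
  obtain ⟨g1, g2⟩ := g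
  have := g2.2
  have := b.2
  split_ifs with h
  · simp only [Prod.mk.injEq, Fin.ext_iff]
    grind
  · simp only [Prod.mk.injEq, Fin.ext_iff]
    grind

open Classical in
/-- The restriction to the `c`-th interval of the basis function of the node `g`, in the local
coordinate. -/
noncomputable def localPoly {M k : ℕ} (r : Fin (k + 1) → ℝ) (g : Fin M × Fin k) (c : Fin M) :
    Polynomial ℝ :=
  ∑ b, if IsNodeOf c b g then Lagrange.basis Finset.univ r b else 0

open Classical in
theorem localPoly_eval_node {M k : ℕ} {r : Fin (k + 1) → ℝ} (hr : Function.Injective r)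
    (g : Fin M × Fin k) (c : Fin M) (b : Fin (k + 1)) :
    (localPoly r g c).eval (r b) = if IsNodeOf c b g then 1 else 0 := by
  unfold localPoly
  rw [Polynomial.eval_finsetSum, Finset.sum_eq_single b]
  · split_ifs <;> simp [Lagrange.eval_basis_self hr.injOn]
  · intro b' _ hb
    split_ifs
    · exact Lagrange.eval_basis_of_ne hb (Finset.mem_univ _)
    · simp
  · simp

/-- Continuity and periodicity of the basis functions. -/
theorem localPoly_eval_one {M k : ℕ} (hk : 0 < k) {r : Fin (k + 1) → ℝ}
    (hr : Function.Injective r) (hr0 : r 0 = 0) (hr1 : r (Fin.last k) = 1)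
    (g : Fin M × Fin k) (c : Fin M) :
    (localPoly r g c).eval 1 = (localPoly r g (finRotate M c)).eval 0 := by
  rw [← hr1, ← hr0, localPoly_eval_node hr, localPoly_eval_node hr]
  simp only [isNodeOf_iff hk]
  simp [localNode, hk]

theorem basis1D_eq_piecewisePoly {ι : Type} (T : Mesh ι) {k : ℕ} (r : Fin (k + 1) → ℝ) (l : ι)
    (g : Fin (T.cells l) × Fin k) : basis1D T r l g = piecewisePoly T l (localPoly r g) := by
  classical
  ext s
  unfold basis1D piecewisePoly localPoly Mesh.localCoord Mesh.interval
  refine Finset.sum_congr rfl fun c _ => ?_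
  rw [Set.indicator_apply]
  simp only [Set.mem_Ico, Polynomial.eval_finsetSum]
  refine if_congr Iff.rfl (Finset.sum_congr rfl fun b _ => ?_) rfl
  split_ifs <;> simp

end

end VlasovFE

/-! ### Finite element functions on the cells of the mesh -/

namespace VlasovFE

/-- The partial derivative in direction `l` of the basis function of the node `i`, with the values
on the cell boundaries extended by the right-sided derivatives. -/
noncomputable def basisGrad {ι : Type} [Fintype ι] [DecidableEq ι] (T : Mesh ι) {k : ℕ}
    (r : Fin (k + 1) → ℝ) (l : ι) (i : Node T k) (z : ι → ℝ) : ℝ :=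
  ∏ l', if l' = l then piecewisePoly T l' (derivPieces T l' (localPoly r (i l'))) (z l')
    else basis1D T r l' (i l') (z l')

/-- The partial derivative in direction `l` of `∑_i u_i ψ_i`, defined cell by cell. -/
noncomputable def gradFun {ι : Type} [Fintype ι] [DecidableEq ι] (T : Mesh ι) {k : ℕ}
    (r : Fin (k + 1) → ℝ) (l : ι) (u : Node T k → ℝ) (z : ι → ℝ) : ℝ :=
  ∑ i, u i * basisGrad T r l i z

/-- The families of polynomials for the partial derivative in direction `l` of tensor-product
Lagrange polynomials. -/
noncomputable def derivFamily {ι : Type} [DecidableEq ι] {k : ℕ} (r : Fin (k + 1) → ℝ) (l : ι) :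
    ι → Fin (k + 1) → Polynomial ℝ :=
  fun l' b => if l' = l then (Lagrange.basis Finset.univ r b).derivative
    else Lagrange.basis Finset.univ r b

/-- The cell over the intervals with the numbers `c l`. -/
def Mesh.cell {ι : Type} (T : Mesh ι) (c : (l : ι) → Fin (T.cells l)) : Set (ι → ℝ) :=
  Set.univ.pi fun l => T.interval l (c l)

/-- The affine map of the cell `c` onto the reference cube. -/
noncomputable def Mesh.localCoords {ι : Type} (T : Mesh ι) (c : (l : ι) → Fin (T.cells l))
    (z : ι → ℝ) : ι → ℝ :=
  fun l => T.localCoord l (c l) (z l)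

/-- The nodal values at the Lagrange points of the cell `c`. -/
def localCoeff {ι : Type} {T : Mesh ι} {k : ℕ} (hk : 0 < k) (u : Node T k → ℝ)
    (c : (l : ι) → Fin (T.cells l)) (j : ι → Fin (k + 1)) : ℝ :=
  u fun l => localNode hk (c l) (j l)

section

variable {ι : Type}

theorem Mesh.localCoords_mem_refCube (T : Mesh ι) {c : (l : ι) → Fin (T.cells l)} {z : ι → ℝ} :
    T.localCoords c z ∈ refCube ι ↔ z ∈ T.cell c := by
  refine forall_congr' fun l => forall_congr' fun _ => ?_
  have hw := T.width_pos l (c l)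
  simp only [localCoords, localCoord, interval, Set.mem_Ico, le_div_iff₀ hw, div_lt_iff₀ hw]
  simp only [width, zero_mul, one_mul, sub_nonneg, sub_lt_sub_iff_right]

variable [Fintype ι] [DecidableEq ι]

theorem Mesh.measurableSet_cell {ι : Type} [Countable ι] (T : Mesh ι)
    (c : (l : ι) → Fin (T.cells l)) : MeasurableSet (T.cell c) :=
  MeasurableSet.univ_pi fun _ => measurableSet_Ico

theorem Mesh.measurableSet_domain {ι : Type} [Countable ι] (T : Mesh ι) :
    MeasurableSet T.domain :=
  MeasurableSet.univ_pi fun _ => measurableSet_Ico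

theorem Mesh.cell_subset_domain {ι : Type} (T : Mesh ι) (c : (l : ι) → Fin (T.cells l)) :
    T.cell c ⊆ T.domain :=
  Set.pi_mono fun l _ => T.interval_subset l (c l)

theorem Mesh.exists_mem_cell {ι : Type} (T : Mesh ι) {z : ι → ℝ} (hz : z ∈ T.domain) :
    ∃ c, z ∈ T.cell c := by
  choose c hc using fun l => T.exists_mem_interval (hz l trivial)
  exact ⟨c, fun l _ => hc l⟩

theorem Mesh.setIntegral_domain (T : Mesh ι) {g : (ι → ℝ) → ℝ} (hg : IntegrableOn g T.domain) :
    ∫ z in T.domain, g z = ∑ c, ∫ z in T.cell c, g z := by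
  have : T.domain = ⋃ c, T.cell c :=
    Set.Subset.antisymm (fun z hz => Set.mem_iUnion.2 (T.exists_mem_cell hz))
      (Set.iUnion_subset T.cell_subset_domain)
  rw [this]
  refine integral_iUnion_fintype T.measurableSet_cell (fun c c' hne => ?_)
    fun c => hg.mono_set (T.cell_subset_domain c)
  refine Set.disjoint_left.2 fun z hz hz' => hne (funext fun l => ?_)
  exact T.interval_inj (hz l trivial) (hz' l trivial)

/-- Expansion of a product over the directions: on a cell only the nodes of that cell contribute. A
node that is several Lagrange points of the cell (a direction with one interval) is counted for each. -/
theorem sum_mul_prod_localNode {T : Mesh ι} {k : ℕ} (hk : 0 < k) (u : Node T k → ℝ)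
    (c : (l : ι) → Fin (T.cells l)) (φ : ι → Fin (k + 1) → ℝ) :
    ∑ i : Node T k, u i * ∏ l, ∑ b, (if i l = localNode hk (c l) b then φ l b else 0) =
      ∑ j, localCoeff hk u c j * ∏ l, φ l (j l) := by
  simp_rw [Finset.prod_univ_sum, Fintype.piFinset_univ, Finset.mul_sum]
  rw [Finset.sum_comm]
  refine Finset.sum_congr rfl fun j _ => ?_
  rw [Finset.sum_eq_single (fun l => localNode hk (c l) (j l))]
  · simp [localCoeff]
  · intro i _ hi
    obtain ⟨l, hl⟩ := Function.ne_iff.1 hi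
    rw [Finset.prod_eq_zero (Finset.mem_univ l) (if_neg hl), mul_zero]
  · simp

theorem localPoly_eval {M k : ℕ} (hk : 0 < k) (r : Fin (k + 1) → ℝ) (g : Fin M × Fin k)
    (c : Fin M) (x : ℝ) :
    (localPoly r g c).eval x = ∑ b, if g = localNode hk c b then
      (Lagrange.basis Finset.univ r b).eval x else 0 := by
  simp only [localPoly, Polynomial.eval_finsetSum, isNodeOf_iff hk]
  refine Finset.sum_congr rfl fun b _ => ?_
  split_ifs <;> simp

theorem localPoly_derivative_eval {M k : ℕ} (hk : 0 < k) (r : Fin (k + 1) → ℝ)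
    (g : Fin M × Fin k) (c : Fin M) (x : ℝ) :
    (localPoly r g c).derivative.eval x = ∑ b, if g = localNode hk c b then
      (Lagrange.basis Finset.univ r b).derivative.eval x else 0 := by
  simp only [localPoly, Polynomial.derivative_sum, Polynomial.eval_finsetSum, isNodeOf_iff hk]
  refine Finset.sum_congr rfl fun b _ => ?_
  split_ifs <;> simp

theorem feFun_of_mem_cell (T : Mesh ι) {k : ℕ} (hk : 0 < k) (r : Fin (k + 1) → ℝ)
    (u : Node T k → ℝ) {c : (l : ι) → Fin (T.cells l)} {z : ι → ℝ} (hz : z ∈ T.cell c) :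
    feFun T r u z =
      tensorPoly (lagrangeFamily ι r) (localCoeff hk u c) (T.localCoords c z) := by
  unfold feFun tensorPoly
  rw [← sum_mul_prod_localNode hk u c
    (fun l b => (lagrangeFamily ι r l b).eval (T.localCoords c z l))]
  refine Finset.sum_congr rfl fun i _ => ?_
  unfold basis
  congr 1
  refine Finset.prod_congr rfl fun l _ => ?_
  rw [basis1D_eq_piecewisePoly, piecewisePoly_of_mem T _ (hz l trivial), localPoly_eval hk]
  rfl

theorem gradFun_of_mem_cell (T : Mesh ι) {k : ℕ} (hk : 0 < k) (r : Fin (k + 1) → ℝ) (l : ι)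
    (u : Node T k → ℝ) {c : (l : ι) → Fin (T.cells l)} {z : ι → ℝ} (hz : z ∈ T.cell c) :
    gradFun T r l u z = (T.width l (c l))⁻¹ *
      tensorPoly (derivFamily r l) (localCoeff hk u c) (T.localCoords c z) := by
  have hprod : ∀ f : ι → ℝ, ∏ l', (if l' = l then (T.width l (c l))⁻¹ else 1) * f l' =
      (T.width l (c l))⁻¹ * ∏ l', f l' := fun f => by
    rw [Finset.prod_mul_distrib, Finset.prod_ite_eq' Finset.univ l, if_pos (Finset.mem_univ _)]
  unfold gradFun tensorPoly
  rw [← sum_mul_prod_localNode hk u c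
    (fun l' b => (derivFamily r l l' b).eval (T.localCoords c z l')), Finset.mul_sum]
  refine Finset.sum_congr rfl fun i _ => ?_
  unfold basisGrad
  rw [mul_left_comm, ← hprod]
  congr 1
  refine Finset.prod_congr rfl fun l' _ => ?_
  by_cases h : l' = l
  · subst h
    simp only [if_true, derivFamily]
    rw [piecewisePoly_of_mem T _ (hz l' trivial), derivPieces, Polynomial.eval_C_mul,
      localPoly_derivative_eval hk]
    rfl
  · simp only [if_neg h, derivFamily, one_mul]
    rw [basis1D_eq_piecewisePoly, piecewisePoly_of_mem T _ (hz l' trivial), localPoly_eval hk]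
    rfl

/-- Transformation of integrals over a cell to the reference cube. -/
theorem setIntegral_cell (T : Mesh ι) (c : (l : ι) → Fin (T.cells l)) {g : (ι → ℝ) → ℝ}
    (hg : Continuous g) :
    ∫ z in T.cell c, g (T.localCoords c z) =
      (∏ l, T.width l (c l)) * ∫ s in refCube ι, g s := by
  set w : ι → ℝ := fun l => T.width l (c l)
  set p : ι → ℝ := fun l => T.pt l (c l).castSucc
  have hw : ∀ l, 0 < w l := fun l => T.width_pos l (c l)
  have hdet : (Matrix.diagonal w).det = ∏ l, w l := Matrix.det_diagonal
  have hpos : 0 < ∏ l, w l := Finset.prod_pos fun l _ => hw l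
  have hcl : Continuous (T.localCoords c) := by
    unfold Mesh.localCoords Mesh.localCoord
    fun_prop
  set F : (ι → ℝ) → ℝ := (T.cell c).indicator fun z => g (T.localCoords c z)
  have hF : Measurable F := (hg.comp hcl).measurable.indicator (T.measurableSet_cell c)
  have hloc : ∀ s, T.localCoords c (p + Matrix.toLin' (Matrix.diagonal w) s) = s := by
    intro s
    ext l
    simp [Mesh.localCoords, Mesh.localCoord, p, w, Matrix.mulVec_diagonal, (hw l).ne']
  have hFs : ∀ s, F (p + Matrix.toLin' (Matrix.diagonal w) s) = (refCube ι).indicator g s := by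
    intro s
    by_cases hs : s ∈ refCube ι
    · rw [Set.indicator_of_mem hs]
      refine (Set.indicator_of_mem ?_ _).trans (by rw [hloc])
      rwa [← Mesh.localCoords_mem_refCube, hloc]
    · rw [Set.indicator_of_notMem hs]
      refine Set.indicator_of_notMem ?_ _
      rwa [← Mesh.localCoords_mem_refCube, hloc]
  rw [← integral_indicator (T.measurableSet_cell c), ← integral_indicator measurableSet_refCube]
  change ∫ z, F z = _
  have hvol := Real.smul_map_diagonal_volume_pi (D := w) (by rw [hdet]; exact hpos.ne')
  have hmap : ∫ z, F (p + z) = (∏ l, w l) *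
      ∫ z, F (p + z) ∂(Measure.map (Matrix.toLin' (Matrix.diagonal w)) volume) := by
    conv_lhs => rw [← hvol, integral_smul_measure, hdet, abs_of_pos hpos,
      ENNReal.toReal_ofReal hpos.le, smul_eq_mul]
  rw [← integral_add_left_eq_self F p, hmap, integral_map]
  · simp_rw [hFs]
  · exact (LinearMap.continuous_on_pi _).aemeasurable
  · exact (hF.comp (measurable_const_add p)).aestronglyMeasurable

/-! ### Boundedness, measurability and derivatives -/

theorem memLp_top_prod {ι : Type} [Fintype ι] (μ : Measure (ι → ℝ)) {f : ι → ℝ → ℝ}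
    (hf : ∀ l, Measurable (f l)) (hb : ∀ l, ∃ R, ∀ s, |f l s| ≤ R) : MemLp (fun z : ι → ℝ => ∏ l, f l (z l)) ⊤ μ := by
  choose R hR using hb
  refine memLp_top_of_bound (Measurable.aestronglyMeasurable
    (Finset.measurable_prod _ fun l _ => (hf l).comp (measurable_pi_apply l))) (∏ l, R l)
    (ae_of_all _ fun z => ?_)
  rw [Real.norm_eq_abs, Finset.abs_prod]
  exact Finset.prod_le_prod (fun _ _ => abs_nonneg _) fun l _ => hR l _

theorem memLp_basis {ι : Type} [Fintype ι] (T : Mesh ι) {k : ℕ} (r : Fin (k + 1) → ℝ) (i : Node T k)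
    (μ : Measure (ι → ℝ)) : MemLp (basis T r i) ⊤ μ := by
  refine memLp_top_prod (f := fun l => basis1D T r l (i l)) μ (fun l => ?_) fun l => ?_ <;>
    simp only [basis1D_eq_piecewisePoly]
  exacts [measurable_piecewisePoly T l _, exists_piecewisePoly_bound T l _]

theorem memLp_basisGrad (T : Mesh ι) {k : ℕ} (r : Fin (k + 1) → ℝ) (l : ι) (i : Node T k)
    (μ : Measure (ι → ℝ)) : MemLp (basisGrad T r l i) ⊤ μ := by
  refine memLp_top_prod (f := fun l' s => if l' = l then
    piecewisePoly T l' (derivPieces T l' (localPoly r (i l'))) s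
    else basis1D T r l' (i l') s) μ (fun l' => ?_) fun l' => ?_ <;>
    simp only [basis1D_eq_piecewisePoly]
  · split_ifs
    exacts [measurable_piecewisePoly T l' _, measurable_piecewisePoly T l' _]
  · split_ifs
    exacts [exists_piecewisePoly_bound T l' _, exists_piecewisePoly_bound T l' _]

theorem memLp_feFun (T : Mesh ι) {k : ℕ} (r : Fin (k + 1) → ℝ) (u : Node T k → ℝ)
    (μ : Measure (ι → ℝ)) : MemLp (feFun T r u) ⊤ μ :=
  memLp_finsetSum _ fun i _ => (memLp_basis T r i μ).const_mul (u i)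

theorem memLp_gradFun (T : Mesh ι) {k : ℕ} (r : Fin (k + 1) → ℝ) (l : ι) (u : Node T k → ℝ)
    (μ : Measure (ι → ℝ)) : MemLp (gradFun T r l u) ⊤ μ :=
  memLp_finsetSum _ fun i _ => (memLp_basisGrad T r l i μ).const_mul (u i)

theorem basis_update (T : Mesh ι) {k : ℕ} (r : Fin (k + 1) → ℝ) (l : ι) (i : Node T k)
    (z : ι → ℝ) (s : ℝ) :
    basis T r i (Function.update z l s) =
      (∏ l' ∈ Finset.univ.erase l, basis1D T r l' (i l') (z l')) *
        piecewisePoly T l (localPoly r (i l)) s := by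
  unfold basis
  rw [← Finset.prod_erase_mul _ _ (Finset.mem_univ l), Function.update_self,
    basis1D_eq_piecewisePoly T r l]
  congr 1
  refine Finset.prod_congr rfl fun l' hl' => ?_
  rw [Function.update_of_ne (Finset.ne_of_mem_erase hl')]

theorem basisGrad_update (T : Mesh ι) {k : ℕ} (r : Fin (k + 1) → ℝ) (l : ι) (i : Node T k)
    (z : ι → ℝ) (s : ℝ) :
    basisGrad T r l i (Function.update z l s) =
      (∏ l' ∈ Finset.univ.erase l, basis1D T r l' (i l') (z l')) *
        piecewisePoly T l (derivPieces T l (localPoly r (i l))) s := by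
  unfold basisGrad
  rw [← Finset.prod_erase_mul _ _ (Finset.mem_univ l), Function.update_self, if_pos rfl]
  congr 1
  refine Finset.prod_congr rfl fun l' hl' => ?_
  rw [Function.update_of_ne (Finset.ne_of_mem_erase hl'), if_neg (Finset.ne_of_mem_erase hl')]

theorem hasDerivAt_basis (T : Mesh ι) {k : ℕ} (r : Fin (k + 1) → ℝ) (l : ι) (i : Node T k)
    {z : ι → ℝ} (hz : z ∈ T.domain) (hne : ∀ n, z l ≠ T.pt l n) :
    HasDerivAt (fun s => basis T r i (Function.update z l s)) (basisGrad T r l i z) (z l) := by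
  have h := basisGrad_update T r l i z (z l)
  rw [Function.update_eq_self] at h
  simp_rw [basis_update, h]
  exact (hasDerivAt_piecewisePoly T _ (hz l trivial) hne).const_mul _

theorem ae_ne_pt {ι : Type} [Fintype ι] (T : Mesh ι) :
    ∀ᵐ z ∂(volume.restrict T.domain : Measure (ι → ℝ)), ∀ l n, z l ≠ T.pt l n :=
  ae_restrict_of_ae (ae_all_iff.2 fun l => ae_all_iff.2 fun n => by
    have := Measure.pi_hyperplane (fun _ : ι => (volume : Measure ℝ)) l (T.pt l n)
    rw [ae_iff]
    simpa [volume_pi] using this)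

theorem pderiv_basis_ae (T : Mesh ι) {k : ℕ} (r : Fin (k + 1) → ℝ) :
    ∀ᵐ z ∂(volume.restrict T.domain : Measure (ι → ℝ)), ∀ l (i : Node T k),
      pderiv l (basis T r i) z = basisGrad T r l i z := by
  filter_upwards [ae_ne_pt T, ae_restrict_mem T.measurableSet_domain] with z hne hz l i
  exact (hasDerivAt_basis T r l i hz (hne l)).deriv

theorem pderiv_feFun_ae (T : Mesh ι) {k : ℕ} (r : Fin (k + 1) → ℝ) :
    ∀ᵐ z ∂(volume.restrict T.domain : Measure (ι → ℝ)), ∀ l (u : Node T k → ℝ),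
      pderiv l (feFun T r u) z = gradFun T r l u z := by
  filter_upwards [ae_ne_pt T, ae_restrict_mem T.measurableSet_domain] with z hne hz l u
  exact (HasDerivAt.fun_sum fun i _ =>
    (hasDerivAt_basis T r l i hz (hne l)).const_mul (u i)).deriv

end

end VlasovFE

/-! ### Skew-symmetry of the advection form -/

namespace VlasovFE

section

variable {ι : Type} [Fintype ι] [DecidableEq ι]

/-- An integral vanishes if the integrals along all lines in one coordinate direction vanish. -/
theorem integral_eq_zero_of_integral_update {g : (ι → ℝ) → ℝ} (l : ι) (hm : Measurable g)
    (hg : Integrable g) (hline : ∀ z, Integrable fun s => g (Function.update z l s))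
    (hzero : ∀ z, ∫ s, g (Function.update z l s) = 0) : ∫ z, g z = 0 := by
  have h : ∫⁻ z, ENNReal.ofReal (g z) = ∫⁻ z, ENNReal.ofReal (-g z) := by
    refine lintegral_eq_of_lmarginal_eq (μ := fun _ : ι => (volume : Measure ℝ)) {l}
      hm.ennreal_ofReal hm.neg.ennreal_ofReal ?_
    rw [lmarginal_singleton, lmarginal_singleton]
    ext z
    have hz := hzero z
    rw [integral_eq_lintegral_pos_part_sub_lintegral_neg_part (hline z), sub_eq_zero] at hz
    exact (ENNReal.toReal_eq_toReal_iff' (hline z).lintegral_lt_top.ne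
      (hline z).neg.lintegral_lt_top.ne).1 hz
  rw [integral_eq_lintegral_pos_part_sub_lintegral_neg_part hg, h, sub_self]

theorem derivPieces_sum {ι : Type} (T : Mesh ι) (l : ι) {κ : Type*} (S : Finset κ) (w : κ → ℝ)
    (p : κ → Fin (T.cells l) → Polynomial ℝ) :
    derivPieces T l (fun c => ∑ i ∈ S, Polynomial.C (w i) * p i c) =
      fun c => ∑ i ∈ S, Polynomial.C (w i) * derivPieces T l (p i) c := by
  ext1 c
  simp only [derivPieces, Polynomial.derivative_sum, Polynomial.derivative_C_mul, Finset.mul_sum]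
  exact Finset.sum_congr rfl fun i _ => by ring

/-- Along a line in direction `l` a finite element function is a continuous periodic piecewise
polynomial. -/
theorem exists_piecewisePoly_line (T : Mesh ι) {k : ℕ} (hk : 0 < k) {r : Fin (k + 1) → ℝ}
    (hr : Function.Injective r) (hr0 : r 0 = 0) (hr1 : r (Fin.last k) = 1) (l : ι)
    (u : Node T k → ℝ) (z : ι → ℝ) :
    ∃ p : Fin (T.cells l) → Polynomial ℝ, (∀ c, (p c).eval 1 = (p (finRotate _ c)).eval 0) ∧
      (∀ s, feFun T r u (Function.update z l s) = piecewisePoly T l p s) ∧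
      ∀ s, gradFun T r l u (Function.update z l s) =
        piecewisePoly T l (derivPieces T l p) s := by
  let w : Node T k → ℝ := fun i =>
    u i * ∏ l' ∈ Finset.univ.erase l, basis1D T r l' (i l') (z l')
  refine ⟨fun c => ∑ i, Polynomial.C (w i) * localPoly r (i l) c, fun c => ?_, fun s => ?_,
    fun s => ?_⟩
  · simp only [Polynomial.eval_finsetSum, Polynomial.eval_C_mul,
      localPoly_eval_one hk hr hr0 hr1]
  · rw [← piecewisePoly_sum T l Finset.univ w fun i => localPoly r (i l)]
    simp only [feFun, basis_update, w, mul_assoc]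
  · rw [derivPieces_sum T l Finset.univ w fun i => localPoly r (i l),
      ← piecewisePoly_sum T l Finset.univ w fun i => derivPieces T l (localPoly r (i l))]
    simp only [gradFun, basisGrad_update, w, mul_assoc]

theorem volume_domain_lt_top {ι : Type} [Fintype ι] (T : Mesh ι) : volume T.domain < ⊤ := by
  rw [Mesh.domain, volume_pi_pi]
  exact ENNReal.prod_lt_top fun l _ => by simp

instance isFiniteMeasure_domain {ι : Type} [Fintype ι] (T : Mesh ι) :
    IsFiniteMeasure (volume.restrict T.domain : Measure (ι → ℝ)) :=
  ⟨by simpa using volume_domain_lt_top T⟩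

theorem integrableOn_of_memLp_top {ι : Type} [Fintype ι] {T : Mesh ι} {g : (ι → ℝ) → ℝ}
    (hg : MemLp g ⊤ (volume.restrict T.domain)) : IntegrableOn g T.domain :=
  hg.integrable le_top

theorem memLp_top_mul {ι : Type} [Fintype ι] {μ : Measure (ι → ℝ)} {g w : (ι → ℝ) → ℝ}
    (hg : MemLp g ⊤ μ) (hw : MemLp w ⊤ μ) : MemLp (fun z => g z * w z) ⊤ μ :=
  hw.mul hg

theorem memLp_top_sq {ι : Type} [Fintype ι] {μ : Measure (ι → ℝ)} {g : (ι → ℝ) → ℝ}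
    (hg : MemLp g ⊤ μ) : MemLp (fun z => g z ^ 2) ⊤ μ := by
  simp_rw [sq]
  exact memLp_top_mul hg hg

theorem measurable_feFun (T : Mesh ι) {k : ℕ} (r : Fin (k + 1) → ℝ) (u : Node T k → ℝ) :
    Measurable (feFun T r u) := by
  unfold feFun basis
  simp_rw [basis1D_eq_piecewisePoly]
  exact Finset.measurable_sum _ fun i _ => (Finset.measurable_prod _ fun l _ =>
    (measurable_piecewisePoly T l _).comp (measurable_pi_apply l)).const_mul _

theorem measurable_gradFun (T : Mesh ι) {k : ℕ} (r : Fin (k + 1) → ℝ) (l : ι)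
    (u : Node T k → ℝ) : Measurable (gradFun T r l u) := by
  unfold gradFun basisGrad
  simp_rw [basis1D_eq_piecewisePoly]
  refine Finset.measurable_sum _ fun i _ => (Finset.measurable_prod _ fun l' _ => ?_).const_mul _
  split_ifs
  exacts [(measurable_piecewisePoly T l' _).comp (measurable_pi_apply l'),
    (measurable_piecewisePoly T l' _).comp (measurable_pi_apply l')]

theorem memLp_top_of_bounded_on_domain {ι : Type} [Fintype ι] (T : Mesh ι) {g : (ι → ℝ) → ℝ}
    (hm : Measurable g) (hb : ∃ R, ∀ z ∈ T.domain, |g z| ≤ R) :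
    MemLp g ⊤ (volume.restrict T.domain) := by
  obtain ⟨R, hR⟩ := hb
  exact memLp_top_of_bound hm.aestronglyMeasurable R
    ((ae_restrict_mem T.measurableSet_domain).mono hR)

/-- Advection in direction `l` by a speed that does not depend on `z_l` conserves the `L²` norm:
integrate by parts along the periodic lines in direction `l`. -/
theorem integral_advection_eq_zero (T : Mesh ι) {k : ℕ} (hk : 0 < k) {r : Fin (k + 1) → ℝ}
    (hr : Function.Injective r) (hr0 : r 0 = 0) (hr1 : r (Fin.last k) = 1) (l : ι)
    (u : Node T k → ℝ) {b : (ι → ℝ) → ℝ} (hm : Measurable b)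
    (hb : ∃ R, ∀ z ∈ T.domain, |b z| ≤ R)
    (hind : ∀ z s, b (Function.update z l s) = b z) :
    ∫ z in T.domain, b z * gradFun T r l u z * feFun T r u z = 0 := by
  rw [← integral_indicator T.measurableSet_domain]
  have hmem : MemLp (fun z => b z * gradFun T r l u z * feFun T r u z) ⊤
      (volume.restrict T.domain) :=
    memLp_top_mul (memLp_top_mul (memLp_top_of_bounded_on_domain T hm hb)
      (memLp_gradFun T r l u _)) (memLp_feFun T r u _)
  have hline : ∀ z, ∃ κ : ℝ, ∃ p : Fin (T.cells l) → Polynomial ℝ,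
      (∀ c, (p c).eval 1 = (p (finRotate _ c)).eval 0) ∧
      ∀ s, T.domain.indicator (fun z => b z * gradFun T r l u z * feFun T r u z)
          (Function.update z l s) =
        κ * (piecewisePoly T l p s * piecewisePoly T l (derivPieces T l p) s) := by
    classical
    intro z
    obtain ⟨p, hp, hF, hG⟩ := exists_piecewisePoly_line T hk hr hr0 hr1 l u z
    refine ⟨if ∀ l', l' ≠ l → z l' ∈ Set.Ico (T.pt l' 0) (T.pt l' (Fin.last _)) then b z else 0,
      p, hp, fun s => ?_⟩
    have hiff : Function.update z l s ∈ T.domain ↔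
        s ∈ Set.Ico (T.pt l 0) (T.pt l (Fin.last _)) ∧
          ∀ l', l' ≠ l → z l' ∈ Set.Ico (T.pt l' 0) (T.pt l' (Fin.last _)) := by
      constructor
      · intro h
        refine ⟨by simpa using h l trivial, fun l' hl' => ?_⟩
        simpa [Function.update_of_ne hl'] using h l' trivial
      · rintro ⟨h1, h2⟩ l' -
        rcases eq_or_ne l' l with rfl | hl'
        · simpa using h1
        · simpa [Function.update_of_ne hl'] using h2 l' hl'
    by_cases hs : s ∈ Set.Ico (T.pt l 0) (T.pt l (Fin.last _))
    · by_cases h2 : ∀ l', l' ≠ l → z l' ∈ Set.Ico (T.pt l' 0) (T.pt l' (Fin.last _))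
      · rw [Set.indicator_of_mem (hiff.2 ⟨hs, h2⟩), if_pos h2, hF, hG, hind]
        ring
      · rw [Set.indicator_of_notMem (fun h => h2 (hiff.1 h).2), if_neg h2, zero_mul]
    · rw [Set.indicator_of_notMem (fun h => hs (hiff.1 h).1), piecewisePoly_of_notMem T p hs]
      ring
  refine integral_eq_zero_of_integral_update l ?_ ?_ (fun z => ?_) fun z => ?_
  · exact ((hm.mul (measurable_gradFun T r l u)).mul (measurable_feFun T r u)).indicator
      T.measurableSet_domain
  · exact (integrable_indicator_iff T.measurableSet_domain).2 (integrableOn_of_memLp_top hmem)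
  · obtain ⟨κ, p, -, h⟩ := hline z
    simp_rw [h]
    refine Integrable.const_mul ?_ _
    have hz : ∀ s ∉ Set.Ico (T.pt l 0) (T.pt l (Fin.last _)),
        piecewisePoly T l p s * piecewisePoly T l (derivPieces T l p) s = 0 := fun s hs => by
      rw [piecewisePoly_of_notMem T _ hs, zero_mul]
    obtain ⟨R, hR⟩ := exists_piecewisePoly_bound T l p
    obtain ⟨R', hR'⟩ := exists_piecewisePoly_bound T l (derivPieces T l p)
    refine (integrableOn_iff_integrable_of_support_subset
      (s := Set.Ico (T.pt l 0) (T.pt l (Fin.last _)))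
      fun s hs => by_contra fun h' => hs (hz s h')).1 ?_
    refine Measure.integrableOn_of_bounded (M := R * R') (by simp)
      ((measurable_piecewisePoly T l _).mul (measurable_piecewisePoly T l _)).aestronglyMeasurable
      (ae_of_all _ fun s => ?_)
    rw [Real.norm_eq_abs, abs_mul]
    exact mul_le_mul (hR s) (hR' s) (abs_nonneg _) ((abs_nonneg _).trans (hR s))
  · obtain ⟨κ, p, hp, h⟩ := hline z
    simp_rw [h]
    rw [integral_const_mul, integral_piecewisePoly_mul_deriv T l p hp, mul_zero]

end

end VlasovFE

/-! ### Essential suprema and nodal mesh sizes -/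

namespace VlasovFE

section

variable {ι : Type}

theorem normLinf_nonneg {S : Set (ι → ℝ)} [Fintype ι] (g : (ι → ℝ) → ℝ) : 0 ≤ normLinf S g :=
  ENNReal.toReal_nonneg

theorem ae_abs_le_normLinf [Fintype ι] {T : Mesh ι} {g : (ι → ℝ) → ℝ}
    (hg : MemLp g ⊤ (volume.restrict T.domain)) {S : Set (ι → ℝ)} (hS : S ⊆ T.domain) :
    ∀ᵐ z ∂(volume.restrict S), |g z| ≤ normLinf S g := by
  have hlt : eLpNorm g ⊤ (volume.restrict S) ≠ ⊤ :=
    (hg.mono_measure (Measure.restrict_mono_set _ hS)).2.ne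
  filter_upwards [enorm_ae_le_eLpNormEssSup g (volume.restrict S)] with z hz
  rw [← eLpNorm_exponent_top] at hz
  have := (ENNReal.toReal_le_toReal enorm_ne_top hlt).2 hz
  simpa [normLinf] using this

theorem normLinf_le_of_ae [Fintype ι] {S : Set (ι → ℝ)} {g : (ι → ℝ) → ℝ} {C : ℝ} (hC : 0 ≤ C)
    (h : ∀ᵐ z ∂(volume.restrict S), |g z| ≤ C) : normLinf S g ≤ C := by
  have h1 : eLpNorm g ⊤ (volume.restrict S) ≤ ENNReal.ofReal C := by
    rw [eLpNorm_exponent_top]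
    exact eLpNormEssSup_le_of_ae_bound h
  exact ENNReal.toReal_le_of_le_ofReal hC h1

theorem memLp_vecNorm [Fintype ι] {T : Mesh ι} {β : (ι → ℝ) → ι → ℝ}
    (hβ : ∀ l, MemLp (fun z => β z l) ⊤ (volume.restrict T.domain)) :
    MemLp (fun z => √(∑ l, β z l ^ 2)) ⊤ (volume.restrict T.domain) := by
  have hsum : MemLp (fun z => ∑ l, |β z l|) ⊤ (volume.restrict T.domain) :=
    memLp_finsetSum _ fun l _ => (hβ l).abs
  refine hsum.mono' ?_ (ae_of_all _ fun z => ?_)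
  · refine Continuous.comp_aestronglyMeasurable Real.continuous_sqrt ?_
    exact Finset.aestronglyMeasurable_fun_sum _ fun l _ => (hβ l).1.pow 2
  · rw [Real.norm_eq_abs, abs_of_nonneg (Real.sqrt_nonneg _)]
    refine Real.sqrt_le_iff.2 ⟨Finset.sum_nonneg fun _ _ => abs_nonneg _, ?_⟩
    refine le_trans (le_of_eq ?_)
      (Finset.sum_sq_le_sq_sum_of_nonneg (s := Finset.univ) (f := fun l => |β z l|)
        fun _ _ => abs_nonneg _)
    simp

theorem ae_abs_le_vecNormLinf [Fintype ι] {T : Mesh ι} {β : (ι → ℝ) → ι → ℝ}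
    (hβ : ∀ l, MemLp (fun z => β z l) ⊤ (volume.restrict T.domain)) (l : ι) :
    ∀ᵐ z ∂(volume.restrict T.domain), |β z l| ≤ vecNormLinf T β := by
  filter_upwards [ae_abs_le_normLinf (memLp_vecNorm hβ) subset_rfl] with z hz
  refine le_trans ?_ ((le_abs_self _).trans hz)
  refine Real.abs_le_sqrt ?_
  exact Finset.single_le_sum (f := fun l => β z l ^ 2) (fun _ _ => sq_nonneg _) (Finset.mem_univ l)

theorem support_basis_subset [Fintype ι] (T : Mesh ι) {k : ℕ} (r : Fin (k + 1) → ℝ)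
    (i : Node T k) : Function.support (basis T r i) ⊆ T.domain := by
  intro z hz l _
  by_contra h
  refine hz (Finset.prod_eq_zero (Finset.mem_univ l) ?_)
  rw [basis1D_eq_piecewisePoly, piecewisePoly_of_notMem T _ h]

theorem normLinf_support_le [Fintype ι] {T : Mesh ι} {β : (ι → ℝ) → ι → ℝ}
    (hβ : ∀ l, MemLp (fun z => β z l) ⊤ (volume.restrict T.domain)) {k : ℕ}
    (r : Fin (k + 1) → ℝ) (l : ι) (i : Node T k) :
    normLinf (Function.support (basis T r i)) (fun z => β z l) ≤ vecNormLinf T β :=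
  normLinf_le_of_ae (normLinf_nonneg _)
    (ae_restrict_of_ae_restrict_of_subset (support_basis_subset T r i)
      (ae_abs_le_vecNormLinf hβ l))

/-- The support of the basis function of a node contains almost every point of a cell with that
node, because a nonzero polynomial has finitely many zeros in each direction. -/
theorem ae_mem_support_basis [Fintype ι] (T : Mesh ι) {k : ℕ} (hk : 0 < k)
    {r : Fin (k + 1) → ℝ} (hr : Function.Injective r) (c : (l : ι) → Fin (T.cells l)) :
    ∀ᵐ z ∂(volume : Measure (ι → ℝ)), z ∈ T.cell c →
      z ∈ Function.support (basis T r fun l => localNode hk (c l) 0) := by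
  have hne : ∀ l, localPoly r (localNode hk (c l) 0) (c l) ≠ 0 := fun l h => by
    have := localPoly_eval_node hr (localNode hk (c l) 0) (c l) 0
    rw [h, if_pos ((isNodeOf_iff hk).2 rfl)] at this
    simp at this
  have h : ∀ᵐ z ∂(volume : Measure (ι → ℝ)), ∀ l,
      ∀ x ∈ (localPoly r (localNode hk (c l) 0) (c l)).roots.toFinset,
        z l ≠ T.pt l (c l).castSucc + x * T.width l (c l) := by
    refine ae_all_iff.2 fun l => (Finset.eventually_all _).2 fun x _ => ?_
    have := Measure.pi_hyperplane (fun _ : ι => (volume : Measure ℝ)) l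
      (T.pt l (c l).castSucc + x * T.width l (c l))
    rw [ae_iff]
    simpa [volume_pi] using this
  filter_upwards [h] with z hz hc
  refine Finset.prod_ne_zero_iff.2 fun l _ h0 => ?_
  rw [basis1D_eq_piecewisePoly, piecewisePoly_of_mem T _ (hc l trivial)] at h0
  refine hz l (T.localCoord l (c l) (z l))
    (by rw [Multiset.mem_toFinset, Polynomial.mem_roots (hne l)]; exact h0) ?_
  rw [Mesh.localCoord, div_mul_cancel₀ _ (T.width_pos l (c l)).ne', add_sub_cancel]

theorem Mesh.hMin_le_width [Finite ι] (T : Mesh ι) (l : ι) (c : Fin (T.cells l)) :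
    T.hMin ≤ T.width l c :=
  ciInf_le (f := fun c : Σ l, Fin (T.cells l) => T.width c.1 c.2) (Set.finite_range _).bddBelow
    ⟨l, c⟩

theorem Mesh.hMin_pos [Finite ι] [Nonempty ι] (T : Mesh ι) : 0 < T.hMin := by
  have : Nonempty (Σ l, Fin (T.cells l)) :=
    ⟨⟨Classical.arbitrary ι, ⟨0, T.cells_pos _⟩⟩⟩
  obtain ⟨c, hc⟩ := exists_eq_ciInf_of_finite (f := fun c : Σ l, Fin (T.cells l) => T.width c.1 c.2)
  rw [Mesh.hMin, ← hc]
  exact T.width_pos _ _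

theorem IsNodalMeshSize.hMin_le [Finite ι] {T : Mesh ι} {k : ℕ} {δ : ι → Node T k → ℝ}
    (hδ : IsNodalMeshSize T δ) (l : ι) (i : Node T k) : T.hMin ≤ δ l i := by
  obtain ⟨⟨c, _, _, h⟩, -⟩ := hδ l i
  exact (T.hMin_le_width l c).trans h

/-- By the grading, cells that share a node have comparable sizes. -/
theorem IsNodalMeshSize.le_mul_width {T : Mesh ι} {σ : ℝ} (hσ : 1 ≤ σ) (hT : T.IsGraded σ) {k : ℕ}
    {δ : ι → Node T k → ℝ} (hδ : IsNodalMeshSize T δ) {l : ι} {i : Node T k}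
    {c : Fin (T.cells l)} {b : Fin (k + 1)} (hc : IsNodeOf c b (i l)) :
    δ l i ≤ σ * T.width l c := by
  obtain ⟨-, c', b', hc', h⟩ := hδ l i
  refine h.trans ?_
  have hself : ∀ d, T.width l d ≤ σ * T.width l d := fun d =>
    le_mul_of_one_le_left (T.width_pos l d).le hσ
  rcases hc with ⟨h1, -⟩ | ⟨-, h1, -⟩ <;> rcases hc' with ⟨h2, -⟩ | ⟨-, h2, -⟩
  · rw [← h1, ← h2]; exact hself _
  · rw [← h1, h2]; exact (hT l c').2
  · rw [← h2, h1]; exact (hT l c).1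
  · rw [(finRotate _).injective (h1.symm.trans h2)]; exact hself _

end

/-! ### Estimates on the cells and their sums -/

section

variable {ι : Type} [Fintype ι] [DecidableEq ι]

theorem degree_derivFamily_lt {ι : Type} [DecidableEq ι] {k : ℕ} {r : Fin (k + 1) → ℝ}
    (hr : Function.Injective r) (l l' : ι) (b : Fin (k + 1)) : (derivFamily r l l' b).degree < (k + 1 : ℕ) := by
  have h : (Lagrange.basis Finset.univ r b).degree < (k + 1 : ℕ) := by
    rw [Lagrange.degree_basis hr.injOn (Finset.mem_univ b), Finset.card_univ, Fintype.card_fin]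
    exact_mod_cast Nat.lt_succ_self k
  unfold derivFamily
  split_ifs
  · exact lt_of_le_of_lt Polynomial.degree_derivative_le h
  · exact h

theorem Mesh.exists_localCoords_eq {ι : Type} (T : Mesh ι) (c : (l : ι) → Fin (T.cells l))
    {s : ι → ℝ} (hs : s ∈ refCube ι) : ∃ z ∈ T.cell c, T.localCoords c z = s := by
  have h : T.localCoords c (fun l => T.pt l (c l).castSucc + s l * T.width l (c l)) = s := by
    ext l
    simp [localCoords, localCoord, (T.width_pos l (c l)).ne']
  exact ⟨_, T.localCoords_mem_refCube.1 (by rwa [h]), h⟩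

theorem setIntegral_cell_feFun_sq (T : Mesh ι) {k : ℕ} (hk : 0 < k) (r : Fin (k + 1) → ℝ)
    (u : Node T k → ℝ) (c : (l : ι) → Fin (T.cells l)) :
    ∫ z in T.cell c, feFun T r u z ^ 2 = (∏ l, T.width l (c l)) *
      ∫ s in refCube ι, tensorPoly (lagrangeFamily ι r) (localCoeff hk u c) s ^ 2 := by
  rw [← setIntegral_cell T c
    (g := fun s => tensorPoly (lagrangeFamily ι r) (localCoeff hk u c) s ^ 2)
    ((continuous_tensorPoly _ _).pow 2)]
  exact setIntegral_congr_fun (T.measurableSet_cell c) fun z hz => by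
    simp only [feFun_of_mem_cell T hk r u hz]

theorem setIntegral_cell_gradFun_sq (T : Mesh ι) {k : ℕ} (hk : 0 < k) (r : Fin (k + 1) → ℝ) (l : ι)
    (u : Node T k → ℝ) (c : (l : ι) → Fin (T.cells l)) :
    ∫ z in T.cell c, gradFun T r l u z ^ 2 = (∏ l, T.width l (c l)) *
      ((T.width l (c l))⁻¹ ^ 2 *
        ∫ s in refCube ι, tensorPoly (derivFamily r l) (localCoeff hk u c) s ^ 2) := by
  rw [← integral_const_mul, ← setIntegral_cell T c (g := fun s => (T.width l (c l))⁻¹ ^ 2 *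
      tensorPoly (derivFamily r l) (localCoeff hk u c) s ^ 2)
    (continuous_const.mul ((continuous_tensorPoly _ _).pow 2))]
  exact setIntegral_congr_fun (T.measurableSet_cell c) fun z hz => by
    simp only [gradFun_of_mem_cell T hk r l u hz, mul_pow]

theorem setIntegral_cell_weighted (T : Mesh ι) {k : ℕ} (hk : 0 < k) (r : Fin (k + 1) → ℝ) (l : ι)
    (e u : Node T k → ℝ) (c : (l : ι) → Fin (T.cells l)) :
    ∫ z in T.cell c, feFun T r e z * gradFun T r l u z ^ 2 = (∏ l, T.width l (c l)) *
      ((T.width l (c l))⁻¹ ^ 2 *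
        ∫ s in refCube ι, tensorPoly (lagrangeFamily ι r) (localCoeff hk e c) s *
          tensorPoly (derivFamily r l) (localCoeff hk u c) s ^ 2) := by
  rw [← integral_const_mul, ← setIntegral_cell T c (g := fun s => (T.width l (c l))⁻¹ ^ 2 *
      (tensorPoly (lagrangeFamily ι r) (localCoeff hk e c) s *
        tensorPoly (derivFamily r l) (localCoeff hk u c) s ^ 2)) (continuous_const.mul
    ((continuous_tensorPoly _ _).mul ((continuous_tensorPoly _ _).pow 2)))]
  exact setIntegral_congr_fun (T.measurableSet_cell c) fun z hz => by
    simp only [feFun_of_mem_cell T hk r e hz, gradFun_of_mem_cell T hk r l u hz]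
    ring

theorem integrableOn_of_memLp_domain {ι : Type} [Fintype ι] {T : Mesh ι} {g : (ι → ℝ) → ℝ}
    (hg : MemLp g ⊤ (volume.restrict T.domain)) (c : (l : ι) → Fin (T.cells l)) :
    IntegrableOn g (T.cell c) :=
  (integrableOn_of_memLp_top hg).mono_set (T.cell_subset_domain c)

/-- The advection term is controlled by the dissipation: on each cell the viscosity in direction `l`
has a nodal value of at least `h_min / (2 k)` times the supremum of `|β_l|` over the cell. -/
theorem exists_integral_advection_sq_le {k : ℕ} (hk : 0 < k) {r : Fin (k + 1) → ℝ}
    (hr : Function.Injective r) :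
    ∃ C > 0, ∀ (T : Mesh ι) (δ : ι → Node T k → ℝ) (_ : IsNodalMeshSize T δ)
      (β : (ι → ℝ) → ι → ℝ) (_ : ∀ l, MemLp (fun z => β z l) ⊤ (volume.restrict T.domain))
      (l : ι) (_ : ∀ z ∈ T.domain, 0 ≤ visc T r δ β l z) (_ : 0 < T.hMin) (u : Node T k → ℝ),
      ∫ z in T.domain, β z l ^ 2 * gradFun T r l u z ^ 2 ≤
        C * (vecNormLinf T β / T.hMin) *
          ∫ z in T.domain, visc T r δ β l z * gradFun T r l u z ^ 2 := by
  choose C hC hCle using fun l : ι =>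
    exists_weighted_norm_equiv (ι := ι) hr (fun l' b => degree_derivFamily_lt hr l l' b)
  have hk' : (0 : ℝ) < k := Nat.cast_pos.2 hk
  refine ⟨∑ l, 2 * k * C l + 1, by
    have := Finset.sum_nonneg fun l (_ : l ∈ Finset.univ) =>
      (mul_pos (mul_pos two_pos hk') (hC l)).le
    linarith, fun T δ hδ β hβ l hnn hh u => ?_⟩
  set V := vecNormLinf T β
  have hV : 0 ≤ V := normLinf_nonneg _
  set e : Node T k → ℝ := fun i =>
    1 / 2 * (δ l i / k) * normLinf (Function.support (basis T r i)) fun z => β z l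
  have hGsq : MemLp (fun z => gradFun T r l u z ^ 2) ⊤ (volume.restrict T.domain) :=
    memLp_top_sq (memLp_gradFun T r l u _)
  have hL : MemLp (fun z => β z l ^ 2 * gradFun T r l u z ^ 2) ⊤ (volume.restrict T.domain) :=
    memLp_top_mul (memLp_top_sq (hβ l)) hGsq
  have hR : MemLp (fun z => feFun T r e z * gradFun T r l u z ^ 2) ⊤ (volume.restrict T.domain) :=
    memLp_top_mul (memLp_feFun T r e _) hGsq
  have hcell : ∀ c, ∫ z in T.cell c, β z l ^ 2 * gradFun T r l u z ^ 2 ≤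
      2 * k * C l * (V / T.hMin) * ∫ z in T.cell c, feFun T r e z * gradFun T r l u z ^ 2 := by
    intro c
    -- One node of the cell suffices: the support of its basis function covers the cell up to a null set.
    set i₀ : Node T k := fun l => localNode hk (c l) 0
    set m := normLinf (Function.support (basis T r i₀)) fun z => β z l
    have hm : 0 ≤ m := normLinf_nonneg _
    have hint : 0 ≤ ∫ z in T.cell c, gradFun T r l u z ^ 2 := integral_nonneg fun _ => sq_nonneg _
    have h1 : ∫ z in T.cell c, β z l ^ 2 * gradFun T r l u z ^ 2 ≤
        V * m * ∫ z in T.cell c, gradFun T r l u z ^ 2 := by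
      rw [← integral_const_mul]
      refine integral_mono_ae (integrableOn_of_memLp_domain hL c)
        ((integrableOn_of_memLp_domain hGsq c).const_mul _) ?_
      have hV' := ae_restrict_of_ae_restrict_of_subset (T.cell_subset_domain c)
        (ae_abs_le_vecNormLinf hβ l)
      have hm' := (ae_restrict_iff'₀ (memLp_basis T r i₀ volume).1.nullMeasurableSet_support).1
        (ae_abs_le_normLinf (hβ l) (support_basis_subset T r i₀))
      filter_upwards [hV', ae_restrict_mem (T.measurableSet_cell c), ae_restrict_of_ae hm',
        ae_restrict_of_ae (ae_mem_support_basis T hk hr c)] with z hz1 hz2 hz3 hz4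
      refine mul_le_mul_of_nonneg_right ?_ (sq_nonneg _)
      rw [← sq_abs, sq]
      exact mul_le_mul hz1 (hz3 (hz4 hz2)) (abs_nonneg _) hV
    have h2 : e i₀ * ∫ z in T.cell c, gradFun T r l u z ^ 2 ≤
        C l * ∫ z in T.cell c, feFun T r e z * gradFun T r l u z ^ 2 := by
      have hloc := hCle l (localCoeff hk e c) (fun s hs => by
        obtain ⟨z, hz, rfl⟩ := T.exists_localCoords_eq c hs
        rw [← feFun_of_mem_cell T hk r e hz]
        exact hnn z (T.cell_subset_domain c hz)) (localCoeff hk u c)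
      have hnorm : e i₀ ≤ ‖localCoeff hk e c‖ :=
        (le_abs_self _).trans (norm_le_pi_norm (localCoeff hk e c) fun _ => 0)
      rw [setIntegral_cell_gradFun_sq T hk, setIntegral_cell_weighted T hk]
      have hw : 0 ≤ (∏ l, T.width l (c l)) * (T.width l (c l))⁻¹ ^ 2 :=
        mul_nonneg (Finset.prod_nonneg fun l _ => (T.width_pos l _).le) (sq_nonneg _)
      have hI : 0 ≤ ∫ s in refCube ι, tensorPoly (derivFamily r l) (localCoeff hk u c) s ^ 2 :=
        integral_nonneg fun _ => sq_nonneg _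
      have := mul_le_mul_of_nonneg_left
        ((mul_le_mul_of_nonneg_right hnorm hI).trans hloc) hw
      linarith
    have h3 : m ≤ 2 * k / T.hMin * e i₀ := by
      have : T.hMin * m ≤ δ l i₀ * m := mul_le_mul_of_nonneg_right (hδ.hMin_le l i₀) hm
      calc m = T.hMin * m / T.hMin := by field_simp
        _ ≤ δ l i₀ * m / T.hMin := by gcongr
        _ = 2 * k / T.hMin * e i₀ := by simp only [e, m]; field_simp
    calc _ ≤ V * m * ∫ z in T.cell c, gradFun T r l u z ^ 2 := h1
      _ ≤ V * (2 * k / T.hMin * e i₀) * ∫ z in T.cell c, gradFun T r l u z ^ 2 := by gcongr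
      _ = V * (2 * k / T.hMin) * (e i₀ * ∫ z in T.cell c, gradFun T r l u z ^ 2) := by ring
      _ ≤ V * (2 * k / T.hMin) *
          (C l * ∫ z in T.cell c, feFun T r e z * gradFun T r l u z ^ 2) := by gcongr
      _ = _ := by ring
  have hRnn : 0 ≤ ∫ z in T.domain, feFun T r e z * gradFun T r l u z ^ 2 :=
    setIntegral_nonneg T.measurableSet_domain fun z hz => mul_nonneg (hnn z hz) (sq_nonneg _)
  change _ ≤ _ * ∫ z in T.domain, feFun T r e z * gradFun T r l u z ^ 2
  calc _ ≤ 2 * k * C l * (V / T.hMin) *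
        ∫ z in T.domain, feFun T r e z * gradFun T r l u z ^ 2 := by
        rw [T.setIntegral_domain (integrableOn_of_memLp_top hL),
          T.setIntegral_domain (integrableOn_of_memLp_top hR), Finset.mul_sum]
        exact Finset.sum_le_sum fun c _ => hcell c
    _ ≤ _ := by
      gcongr
      have := Finset.single_le_sum (f := fun l => 2 * k * C l)
        (fun l _ => (mul_pos (mul_pos two_pos hk') (hC l)).le) (Finset.mem_univ l)
      linarith

/-- The diffusion form is bounded by the `L²` norm: on each cell the viscosity in direction `l` is at
most a constant times the cell size, and the inverse estimate costs two powers of that size. -/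
theorem exists_integral_viscosity_le {k : ℕ} (hk : 0 < k) {r : Fin (k + 1) → ℝ}
    (hr : Function.Injective r) {σ : ℝ} (hσ : 1 ≤ σ) :
    ∃ C > 0, ∀ (T : Mesh ι) (_ : T.IsGraded σ) (δ : ι → Node T k → ℝ) (_ : IsNodalMeshSize T δ)
      (β : (ι → ℝ) → ι → ℝ) (_ : ∀ l, MemLp (fun z => β z l) ⊤ (volume.restrict T.domain))
      (l : ι) (_ : 0 < T.hMin) (u : Node T k → ℝ),
      ∫ z in T.domain, visc T r δ β l z * gradFun T r l u z ^ 2 ≤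
        C * (vecNormLinf T β / T.hMin) * ∫ z in T.domain, feFun T r u z ^ 2 := by
  obtain ⟨Λ, hΛ, hup⟩ := exists_tensorPoly_bound (lagrangeFamily ι r)
  choose C hC hCle using fun l : ι => exists_inverse_estimate (ι := ι) hr (derivFamily r l)
  have hk' : (0 : ℝ) < k := Nat.cast_pos.2 hk
  have hσ0 : 0 < σ := one_pos.trans_le hσ
  have hcpos : ∀ l, 0 < Λ * σ * C l / (2 * k) := fun l => by have := hC l; positivity
  refine ⟨∑ l, Λ * σ * C l / (2 * k) + 1, by
    have := Finset.sum_nonneg fun l (_ : l ∈ Finset.univ) => (hcpos l).le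
    linarith, fun T hT δ hδ β hβ l hh u => ?_⟩
  set V := vecNormLinf T β
  have hV : 0 ≤ V := normLinf_nonneg _
  set e : Node T k → ℝ := fun i =>
    1 / 2 * (δ l i / k) * normLinf (Function.support (basis T r i)) fun z => β z l
  have hGsq : MemLp (fun z => gradFun T r l u z ^ 2) ⊤ (volume.restrict T.domain) :=
    memLp_top_sq (memLp_gradFun T r l u _)
  have hFsq : MemLp (fun z => feFun T r u z ^ 2) ⊤ (volume.restrict T.domain) :=
    memLp_top_sq (memLp_feFun T r u _)
  have hR : MemLp (fun z => feFun T r e z * gradFun T r l u z ^ 2) ⊤ (volume.restrict T.domain) :=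
    memLp_top_mul (memLp_feFun T r e _) hGsq
  have hcell : ∀ c, ∫ z in T.cell c, feFun T r e z * gradFun T r l u z ^ 2 ≤
      Λ * σ * C l / (2 * k) * (V / T.hMin) * ∫ z in T.cell c, feFun T r u z ^ 2 := by
    intro c
    set w := T.width l (c l)
    have hw : 0 < w := T.width_pos l (c l)
    have hnorm : ‖localCoeff hk e c‖ ≤ 1 / 2 * (σ * w / k) * V := by
      refine (pi_norm_le_iff_of_nonneg (by positivity)).2 fun j => ?_
      have hδ0 : 0 ≤ δ l (fun l => localNode hk (c l) (j l)) := hh.le.trans (hδ.hMin_le l _)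
      rw [Real.norm_eq_abs, localCoeff, abs_of_nonneg
        (mul_nonneg (by positivity) (normLinf_nonneg _))]
      have h1 := hδ.le_mul_width hσ hT (l := l) (i := fun l => localNode hk (c l) (j l))
        (c := c l) (b := j l) ((isNodeOf_iff hk).2 rfl)
      have h2 := normLinf_support_le hβ r l (fun l => localNode hk (c l) (j l))
      have h3 := normLinf_nonneg (S := Function.support (basis T r fun l => localNode hk (c l) (j l)))
        fun z => β z l
      gcongr
    have h1 : ∫ z in T.cell c, feFun T r e z * gradFun T r l u z ^ 2 ≤
        Λ * (1 / 2 * (σ * w / k) * V) * ∫ z in T.cell c, gradFun T r l u z ^ 2 := by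
      rw [← integral_const_mul]
      refine setIntegral_mono_on (integrableOn_of_memLp_domain hR c)
        ((integrableOn_of_memLp_domain hGsq c).const_mul _) (T.measurableSet_cell c) fun z hz => ?_
      refine mul_le_mul_of_nonneg_right ?_ (sq_nonneg _)
      rw [feFun_of_mem_cell T hk r e hz]
      exact (le_abs_self _).trans ((hup _ _ (T.localCoords_mem_refCube.2 hz)).trans
        (mul_le_mul_of_nonneg_left hnorm hΛ.le))
    have h2 : ∫ z in T.cell c, gradFun T r l u z ^ 2 ≤
        C l * w⁻¹ ^ 2 * ∫ z in T.cell c, feFun T r u z ^ 2 := by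
      rw [setIntegral_cell_gradFun_sq T hk, setIntegral_cell_feFun_sq T hk]
      have hp : 0 ≤ (∏ l, T.width l (c l)) * w⁻¹ ^ 2 :=
        mul_nonneg (Finset.prod_nonneg fun l _ => (T.width_pos l _).le) (sq_nonneg _)
      have := mul_le_mul_of_nonneg_left (hCle l (localCoeff hk u c)) hp
      linarith
    have hF : 0 ≤ ∫ z in T.cell c, feFun T r u z ^ 2 := integral_nonneg fun _ => sq_nonneg _
    have hCl := hC l
    calc _ ≤ Λ * (1 / 2 * (σ * w / k) * V) *
          (C l * w⁻¹ ^ 2 * ∫ z in T.cell c, feFun T r u z ^ 2) :=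
          h1.trans (mul_le_mul_of_nonneg_left h2 (by positivity))
      _ = Λ * σ * C l / (2 * k) * (V / w) * ∫ z in T.cell c, feFun T r u z ^ 2 := by field_simp
      _ ≤ _ := by
        gcongr
        exact T.hMin_le_width l (c l)
  have hFnn : 0 ≤ ∫ z in T.domain, feFun T r u z ^ 2 := integral_nonneg fun _ => sq_nonneg _
  change ∫ z in T.domain, feFun T r e z * gradFun T r l u z ^ 2 ≤ _
  calc _ ≤ Λ * σ * C l / (2 * k) * (V / T.hMin) * ∫ z in T.domain, feFun T r u z ^ 2 := by
        rw [T.setIntegral_domain (integrableOn_of_memLp_top hR),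
          T.setIntegral_domain (integrableOn_of_memLp_top hFsq), Finset.mul_sum]
        exact Finset.sum_le_sum fun c _ => hcell c
    _ ≤ _ := by
      gcongr
      have := Finset.single_le_sum (f := fun l => Λ * σ * C l / (2 * k))
        (fun l _ => (hcpos l).le) (Finset.mem_univ l)
      linarith

end

end VlasovFE

/-! ### The weak form of the scheme and the energy estimate for one step -/

namespace VlasovFE

section

variable {ι : Type} [Fintype ι] [DecidableEq ι]

theorem sum_mul_sum_integral_mul {ι : Type} {κ : Type*} [Fintype κ] {μ : Measure (ι → ℝ)}
    {F : κ → κ → (ι → ℝ) → ℝ} (hF : ∀ i j, Integrable (F i j) μ) (x w : κ → ℝ) :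
    ∑ i, w i * ∑ j, (∫ z, F i j z ∂μ) * x j = ∫ z, ∑ i, ∑ j, w i * (F i j z * x j) ∂μ := by
  rw [integral_finsetSum _ fun i _ => integrable_finsetSum _ fun j _ =>
    ((hF i j).mul_const _).const_mul _]
  refine Finset.sum_congr rfl fun i _ => ?_
  rw [integral_finsetSum _ fun j _ => ((hF i j).mul_const _).const_mul _, Finset.mul_sum]
  refine Finset.sum_congr rfl fun j _ => ?_
  rw [integral_const_mul, integral_mul_const]

theorem sum_massMat (T : Mesh ι) {k : ℕ} (r : Fin (k + 1) → ℝ) (x w : Node T k → ℝ) :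
    ∑ i, w i * ∑ j, massMat T r i j * x j =
      ∫ z in T.domain, feFun T r x z * feFun T r w z := by
  unfold massMat innerL2
  rw [sum_mul_sum_integral_mul fun i j => integrableOn_of_memLp_top
    (memLp_top_mul (memLp_basis T r j _) (memLp_basis T r i _))]
  congr 1
  ext z
  unfold feFun
  rw [mul_comm (∑ i, x i * _), Finset.sum_mul_sum]
  exact Finset.sum_congr rfl fun i _ => Finset.sum_congr rfl fun j _ => by ring

theorem sum_advMat (T : Mesh ι) {k : ℕ} (r : Fin (k + 1) → ℝ) {β : (ι → ℝ) → ι → ℝ}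
    (hβ : ∀ l, MemLp (fun z => β z l) ⊤ (volume.restrict T.domain)) (x w : Node T k → ℝ) :
    ∑ i, w i * ∑ j, advMat T r β i j * x j =
      ∫ z in T.domain, (∑ l, β z l * gradFun T r l x z) * feFun T r w z := by
  have h : ∀ i j, advMat T r β i j =
      ∫ z in T.domain, (∑ l, β z l * basisGrad T r l j z) * basis T r i z := fun i j => by
    refine integral_congr_ae ?_
    filter_upwards [pderiv_basis_ae T r] with z hz
    simp only [hz]
  simp_rw [h]
  rw [sum_mul_sum_integral_mul fun i j => integrableOn_of_memLp_top
    (memLp_top_mul (memLp_finsetSum _ fun l _ => memLp_top_mul (hβ l) (memLp_basisGrad T r l j _))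
      (memLp_basis T r i _))]
  congr 1
  ext z
  have hg : ∑ l, β z l * gradFun T r l x z = ∑ j, x j * ∑ l, β z l * basisGrad T r l j z := by
    simp only [gradFun, Finset.mul_sum]
    rw [Finset.sum_comm]
    exact Finset.sum_congr rfl fun i _ => Finset.sum_congr rfl fun j _ => by ring
  rw [hg]
  unfold feFun
  rw [mul_comm (∑ i, x i * _), Finset.sum_mul_sum]
  exact Finset.sum_congr rfl fun i _ => Finset.sum_congr rfl fun j _ => by ring

theorem sum_diffMat (T : Mesh ι) {k : ℕ} (r : Fin (k + 1) → ℝ) {a : ι → (ι → ℝ) → ℝ}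
    (ha : ∀ l, MemLp (a l) ⊤ (volume.restrict T.domain)) (x w : Node T k → ℝ) :
    ∑ i, w i * ∑ j, diffMat T r a i j * x j =
      ∫ z in T.domain, ∑ l, a l z * gradFun T r l x z * gradFun T r l w z := by
  have h : ∀ i j, diffMat T r a i j =
      ∫ z in T.domain, ∑ l, a l z * basisGrad T r l j z * basisGrad T r l i z := fun i j => by
    refine integral_congr_ae ?_
    filter_upwards [pderiv_basis_ae T r] with z hz
    simp only [hz]
  simp_rw [h]
  rw [sum_mul_sum_integral_mul fun i j => integrableOn_of_memLp_top
    (memLp_finsetSum _ fun l _ => memLp_top_mul (memLp_top_mul (ha l) (memLp_basisGrad T r l j _))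
      (memLp_basisGrad T r l i _))]
  congr 1
  ext z
  have hl : ∀ l, a l z * gradFun T r l x z * gradFun T r l w z =
      ∑ i, ∑ j, w i * (a l z * basisGrad T r l j z * basisGrad T r l i z * x j) := fun l => by
    rw [mul_comm]
    simp only [gradFun, Finset.mul_sum, Finset.sum_mul]
    rw [Finset.sum_comm]
    exact Finset.sum_congr rfl fun i _ => Finset.sum_congr rfl fun j _ => by ring
  simp_rw [hl]
  symm
  rw [Finset.sum_comm]
  refine Finset.sum_congr rfl fun i _ => ?_
  rw [Finset.sum_comm]
  refine Finset.sum_congr rfl fun j _ => ?_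
  rw [Finset.sum_mul, Finset.mul_sum]

/-- The scheme, tested with an arbitrary finite element function. -/
theorem EulerStep.weak {T : Mesh ι} {k : ℕ} {r : Fin (k + 1) → ℝ} {β : (ι → ℝ) → ι → ℝ}
    {a : ι → (ι → ℝ) → ℝ} (hβ : ∀ l, MemLp (fun z => β z l) ⊤ (volume.restrict T.domain))
    (ha : ∀ l, MemLp (a l) ⊤ (volume.restrict T.domain)) {τ : ℝ} {u u' : Node T k → ℝ}
    (h : EulerStep T r β a τ u u') (w : Node T k → ℝ) :
    (∫ z in T.domain, feFun T r (u' - u) z * feFun T r w z) / τ +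
      (∫ z in T.domain, (∑ l, β z l * gradFun T r l u z) * feFun T r w z) +
      ∫ z in T.domain, ∑ l, a l z * gradFun T r l u z * gradFun T r l w z = 0 := by
  rw [← sum_massMat, ← sum_advMat T r hβ, ← sum_diffMat T r ha, Finset.sum_div,
    ← Finset.sum_add_distrib, ← Finset.sum_add_distrib]
  refine Finset.sum_eq_zero fun i _ => ?_
  have h2 : w i * (∑ j, massMat T r i j * (u' - u) j) / τ =
      w i * ∑ j, massMat T r i j * ((u' j - u j) / τ) := by
    rw [mul_div_assoc, Finset.sum_div]
    simp_rw [Pi.sub_apply, mul_div_assoc]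
  rw [h2, ← mul_add, ← mul_add, h i, mul_zero]

theorem feFun_sub (T : Mesh ι) {k : ℕ} (r : Fin (k + 1) → ℝ) (u u' : Node T k → ℝ) (z : ι → ℝ) :
    feFun T r (u' - u) z = feFun T r u' z - feFun T r u z := by
  simp [feFun, sub_mul, Finset.sum_sub_distrib]

theorem dissipation_eq {T : Mesh ι} {k : ℕ} (r : Fin (k + 1) → ℝ) {a : ι → (ι → ℝ) → ℝ}
    (hnn : ∀ l, ∀ z ∈ T.domain, 0 ≤ a l z) (u : Node T k → ℝ) :
    dissipation T a (feFun T r u) =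
      ∫ z in T.domain, ∑ l, a l z * gradFun T r l u z ^ 2 := by
  refine integral_congr_ae ?_
  filter_upwards [pderiv_feFun_ae T r, ae_restrict_mem T.measurableSet_domain] with z hz hzd
  refine Finset.sum_congr rfl fun l _ => ?_
  rw [hz, mul_pow, Real.sq_sqrt (hnn l z hzd)]

theorem dissipation_nonneg (T : Mesh ι) (a : ι → (ι → ℝ) → ℝ) (g : (ι → ℝ) → ℝ) :
    0 ≤ dissipation T a g :=
  integral_nonneg fun _ => Finset.sum_nonneg fun _ _ => sq_nonneg _

/-- The energy identity for one step loses `2 τ` times the dissipation and gains the square of the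
increment. Testing the scheme with the increment and absorbing by Young's inequality bounds this
gain by `2 τ² (‖β‖_∞ / h_min)` times the dissipation, up to constants. -/
theorem EulerStep.normSqL2_le [Nonempty ι] {T : Mesh ι} {k : ℕ} (hk : 0 < k) {r : Fin (k + 1) → ℝ}
    (hr : Function.Injective r) (hr0 : r 0 = 0) (hr1 : r (Fin.last k) = 1)
    {β : (ι → ℝ) → ι → ℝ} {a : ι → (ι → ℝ) → ℝ} (hβm : ∀ l, Measurable fun z => β z l)
    (hβb : ∀ l, ∃ R, ∀ z ∈ T.domain, |β z l| ≤ R)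
    (hind : ∀ l z s, β (Function.update z l s) l = β z l)
    (ha : ∀ l, MemLp (a l) ⊤ (volume.restrict T.domain))
    (hnn : ∀ l, ∀ z ∈ T.domain, 0 ≤ a l z) {τ : ℝ} (hτ : 0 < τ) {u u' : Node T k → ℝ}
    (h : EulerStep T r β a τ u u') {C₁ C₂ : ℝ} (hC₂ : 0 < C₂)
    (h₁ : ∀ l, ∫ z in T.domain, β z l ^ 2 * gradFun T r l u z ^ 2 ≤
      C₁ * ∫ z in T.domain, a l z * gradFun T r l u z ^ 2)
    (h₂ : ∀ l, ∀ w : Node T k → ℝ, ∫ z in T.domain, a l z * gradFun T r l w z ^ 2 ≤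
      C₂ * ∫ z in T.domain, feFun T r w z ^ 2) :
    normSqL2 T (feFun T r u') + (1 - τ * (Fintype.card ι * (C₁ + C₂))) * (2 * τ *
      dissipation T a (feFun T r u)) ≤ normSqL2 T (feFun T r u) := by
  have hd : (0 : ℝ) < Fintype.card ι := Nat.cast_pos.2 Fintype.card_pos
  have hβ : ∀ l, MemLp (fun z => β z l) ⊤ (volume.restrict T.domain) := fun l =>
    memLp_top_of_bounded_on_domain T (hβm l) (hβb l)
  set d : ℝ := (Fintype.card ι : ℝ)
  set F := feFun T r
  set G := gradFun T r
  set w := u' - u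
  have hF : ∀ x, MemLp (F x) ⊤ (volume.restrict T.domain) := fun x => memLp_feFun T r x _
  have hG : ∀ l x, MemLp (G l x) ⊤ (volume.restrict T.domain) := fun l x => memLp_gradFun T r l x _
  have hb : MemLp (fun z => ∑ l, β z l * G l u z) ⊤ (volume.restrict T.domain) :=
    memLp_finsetSum _ fun l _ => memLp_top_mul (hβ l) (hG l u)
  have haG : ∀ l x, MemLp (fun z => a l z * G l x z ^ 2) ⊤ (volume.restrict T.domain) :=
    fun l x => memLp_top_mul (ha l) (memLp_top_sq (hG l x))
  rw [dissipation_eq r hnn]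
  set D := ∫ z in T.domain, ∑ l, a l z * G l u z ^ 2
  have hD : D = ∑ l, ∫ z in T.domain, a l z * G l u z ^ 2 :=
    integral_finsetSum _ fun l _ => integrableOn_of_memLp_top (haG l u)
  set X := ∫ z in T.domain, F w z ^ 2
  -- The energy identity, from the scheme tested with the old solution.
  have htest : ∫ z in T.domain, F w z * F u z = -τ * D := by
    have hw := h.weak hβ ha u
    have hskew : ∫ z in T.domain, (∑ l, β z l * G l u z) * F u z = 0 := by
      simp_rw [Finset.sum_mul]
      rw [integral_finsetSum _ fun l _ => integrableOn_of_memLp_top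
        (memLp_top_mul (memLp_top_mul (hβ l) (hG l u)) (hF u))]
      exact Finset.sum_eq_zero fun l _ =>
        integral_advection_eq_zero T hk hr hr0 hr1 l u (hβm l) (hβb l) (hind l)
    have hDeq : ∫ z in T.domain, ∑ l, a l z * G l u z * G l u z = D := by
      simp_rw [D, sq, mul_assoc]
    change (∫ z in T.domain, F w z * F u z) / τ +
      (∫ z in T.domain, (∑ l, β z l * G l u z) * F u z) +
      ∫ z in T.domain, ∑ l, a l z * G l u z * G l u z = 0 at hw
    rw [hskew, hDeq] at hw
    field_simp at hw
    linarith
  have henergy : normSqL2 T (F u') = normSqL2 T (F u) + 2 * (-τ * D) + X := by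
    rw [← htest, ← integral_const_mul, normSqL2, normSqL2, ← integral_add, ← integral_add]
    · refine integral_congr_ae (ae_of_all _ fun z => ?_)
      simp only [F, w, feFun_sub]
      ring
    · exact (integrableOn_of_memLp_top (memLp_top_sq (hF u))).add
        ((integrableOn_of_memLp_top (memLp_top_mul (hF w) (hF u))).const_mul _)
    · exact integrableOn_of_memLp_top (memLp_top_sq (hF w))
    · exact integrableOn_of_memLp_top (memLp_top_sq (hF u))
    · exact (integrableOn_of_memLp_top (memLp_top_mul (hF w) (hF u))).const_mul _
  have hY : ∫ z in T.domain, (∑ l, β z l * G l u z) ^ 2 ≤ d * C₁ * D := by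
    calc _ ≤ ∫ z in T.domain, ∑ l, d * (β z l ^ 2 * G l u z ^ 2) := by
          refine integral_mono (integrableOn_of_memLp_top (memLp_top_sq hb))
            (integrable_finsetSum _ fun l _ => Integrable.const_mul (integrableOn_of_memLp_top
              (memLp_top_mul (memLp_top_sq (hβ l)) (memLp_top_sq (hG l u)))) _) fun z => ?_
          have := sq_sum_le_card_mul_sum_sq (s := Finset.univ) (f := fun l => β z l * G l u z)
          simpa [← Finset.mul_sum, mul_pow, d] using this
      _ = d * ∑ l, ∫ z in T.domain, β z l ^ 2 * G l u z ^ 2 := by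
          rw [integral_finsetSum _ fun l _ => Integrable.const_mul (integrableOn_of_memLp_top
              (memLp_top_mul (memLp_top_sq (hβ l)) (memLp_top_sq (hG l u)))) _]
          simp_rw [integral_const_mul, Finset.mul_sum]
      _ ≤ d * ∑ l, C₁ * ∫ z in T.domain, a l z * G l u z ^ 2 := by
          gcongr with l
          exact h₁ l
      _ = d * C₁ * D := by rw [hD, ← Finset.mul_sum, mul_assoc]
  have hZ : ∫ z in T.domain, ∑ l, a l z * G l w z ^ 2 ≤ d * C₂ * X := by
    rw [integral_finsetSum _ fun l _ => integrableOn_of_memLp_top (haG l w)]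
    calc _ ≤ ∑ l : ι, C₂ * X := Finset.sum_le_sum fun l _ => h₂ l w
      _ = d * C₂ * X := by simp [d, mul_assoc]
  -- Young's inequality, with the weight `θ` for which the last term is `X / 4`.
  set θ := τ * (d * C₂)
  have hθ : 0 < θ := by positivity
  have hinc : X ≤ τ ^ 2 * (d * C₁ * D) + X / 4 + (τ * θ * D + τ / (4 * θ) * (d * C₂ * X)) := by
    have hw := h.weak hβ ha w
    change (∫ z in T.domain, F w z * F w z) / τ +
      (∫ z in T.domain, (∑ l, β z l * G l u z) * F w z) +
      ∫ z in T.domain, ∑ l, a l z * G l u z * G l w z = 0 at hw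
    have hXeq : ∫ z in T.domain, F w z * F w z = X := by simp_rw [X, sq]
    rw [hXeq] at hw
    have hy1 : -τ * (∫ z in T.domain, (∑ l, β z l * G l u z) * F w z) ≤
        τ ^ 2 * (∫ z in T.domain, (∑ l, β z l * G l u z) ^ 2) + 1 / 4 * X := by
      rw [← integral_const_mul, ← integral_const_mul, ← integral_const_mul, ← integral_add]
      · refine integral_mono ((integrableOn_of_memLp_top (memLp_top_mul hb (hF w))).const_mul _)
          (((integrableOn_of_memLp_top (memLp_top_sq hb)).const_mul _).add
          ((integrableOn_of_memLp_top (memLp_top_sq (hF w))).const_mul _)) fun z => ?_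
        simp only
        nlinarith [sq_nonneg (τ * (∑ l, β z l * G l u z) + F w z / 2)]
      · exact (integrableOn_of_memLp_top (memLp_top_sq hb)).const_mul _
      · exact (integrableOn_of_memLp_top (memLp_top_sq (hF w))).const_mul _
    have hsum : ∀ x, IntegrableOn (fun z => ∑ l, a l z * G l x z ^ 2) T.domain := fun x =>
      integrableOn_of_memLp_top (memLp_finsetSum _ fun l _ => haG l x)
    have hy2 : -τ * (∫ z in T.domain, ∑ l, a l z * G l u z * G l w z) ≤
        τ * θ * D + τ / (4 * θ) * ∫ z in T.domain, ∑ l, a l z * G l w z ^ 2 := by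
      rw [← integral_const_mul, ← integral_const_mul, ← integral_const_mul, ← integral_add]
      · refine setIntegral_mono_on (Integrable.const_mul (integrableOn_of_memLp_top
          (memLp_finsetSum _ fun l _ => memLp_top_mul (memLp_top_mul (ha l) (hG l u)) (hG l w))) _)
          (((hsum u).const_mul _).add ((hsum w).const_mul _)) T.measurableSet_domain
          fun z hz => ?_
        rw [Finset.mul_sum, Finset.mul_sum, Finset.mul_sum, ← Finset.sum_add_distrib]
        refine Finset.sum_le_sum fun l _ => ?_
        have hy : -(G l u z * G l w z) ≤ θ * G l u z ^ 2 + 1 / (4 * θ) * G l w z ^ 2 := by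
          have : θ * G l u z ^ 2 + 1 / (4 * θ) * G l w z ^ 2 + G l u z * G l w z =
              θ * (G l u z + G l w z / (2 * θ)) ^ 2 := by field_simp; ring
          have h0 : 0 ≤ θ * (G l u z + G l w z / (2 * θ)) ^ 2 := by positivity
          linarith
        have := mul_le_mul_of_nonneg_left hy (mul_nonneg hτ.le (hnn l z hz))
        calc _ = τ * a l z * -(G l u z * G l w z) := by ring
          _ ≤ _ := this
          _ = _ := by ring
      · exact (hsum u).const_mul _
      · exact (hsum w).const_mul _
    have hX : X = -τ * (∫ z in T.domain, (∑ l, β z l * G l u z) * F w z) +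
        -τ * ∫ z in T.domain, ∑ l, a l z * G l u z * G l w z := by
      field_simp at hw
      linarith
    have hY' := mul_le_mul_of_nonneg_left hY (sq_nonneg τ)
    have hZ' := mul_le_mul_of_nonneg_left hZ (by positivity : 0 ≤ τ / (4 * θ))
    linarith
  have hθX : τ / (4 * θ) * (d * C₂ * X) = X / 4 := by
    simp only [θ]
    field_simp
  rw [henergy]
  simp only [θ] at hinc hθX
  nlinarith

end

end VlasovFE

/-! ### The Vlasov advection field -/

namespace VlasovFE

section

variable {dx dv : ℕ}

theorem velocity_update_inr (z : Coord dx dv → ℝ) (l : Fin dv) (s : ℝ) {a : Fin 3}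
    (ha : (a : ℕ) ≠ l) : velocity (Function.update z (Sum.inr l) s) a = velocity z a := by
  unfold velocity
  split_ifs with h
  · rw [Function.update_of_ne]
    simpa [Fin.ext_iff] using ha
  · rfl

/-- The speed in each direction does not depend on the coordinate of that direction; for the velocity
directions this is because `(v × B)_l` does not involve `v_l`. -/
theorem advection_update (hx : dx ≤ dv) (hv : dv ≤ 3) (E B : (Fin dx → ℝ) → Fin 3 → ℝ)
    (l : Coord dx dv) (z : Coord dx dv → ℝ) (s : ℝ) :
    advection hx hv E B (Function.update z l s) l = advection hx hv E B z l := by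
  rcases l with l | l
  · simp [advection]
  · have hcross : ∀ (a : Fin 3) (v w b : Fin 3 → ℝ), (∀ a', a' ≠ a → v a' = w a') →
        (v ⨯₃ b) a = (w ⨯₃ b) a := by
      intro a v w b h
      fin_cases a <;> simp only [cross_apply] <;> simp <;>
        rw [h _ (by decide), h _ (by decide)]
    have hc := hcross (Fin.castLE hv l) (velocity (Function.update z (Sum.inr l) s)) (velocity z)
      (B fun j => z (Sum.inl j)) fun a' ha' =>
        velocity_update_inr z l s fun h => ha' (Fin.ext h)
    simp only [advection, Pi.add_apply, ne_eq, reduceCtorEq, not_false_eq_true,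
      Function.update_of_ne, hc]

theorem measurable_velocity (a : Fin 3) : Measurable fun z : Coord dx dv → ℝ => velocity z a := by
  unfold velocity
  split_ifs
  exacts [measurable_pi_apply _, measurable_const]

theorem measurable_advection (hx : dx ≤ dv) (hv : dv ≤ 3) {E B : (Fin dx → ℝ) → Fin 3 → ℝ}
    (hE : Measurable E) (hB : Measurable B) (l : Coord dx dv) :
    Measurable fun z => advection hx hv E B z l := by
  rcases l with l | l
  · exact measurable_pi_apply _
  · have hp : Measurable fun z : Coord dx dv → ℝ => fun j => z (Sum.inl j) :=
      measurable_pi_lambda _ fun j => measurable_pi_apply _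
    have hEa : ∀ a, Measurable fun z : Coord dx dv → ℝ => E (fun j => z (Sum.inl j)) a := fun a =>
      (measurable_pi_apply a).comp (hE.comp hp)
    have hBa : ∀ a, Measurable fun z : Coord dx dv → ℝ => B (fun j => z (Sum.inl j)) a := fun a =>
      (measurable_pi_apply a).comp (hB.comp hp)
    have hcross : ∀ a : Fin 3, Measurable fun z : Coord dx dv → ℝ =>
        (velocity z ⨯₃ B (fun j => z (Sum.inl j))) a := by
      have := measurable_velocity (dx := dx) (dv := dv)
      intro a
      fin_cases a <;> simp only [cross_apply] <;>
        exact ((this _).mul (hBa _)).sub ((this _).mul (hBa _))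
    exact (hEa _).add (hcross _)

theorem exists_advection_bound (hx : dx ≤ dv) (hv : dv ≤ 3) (T : Mesh (Coord dx dv))
    {E B : (Fin dx → ℝ) → Fin 3 → ℝ}
    (hEB : ∃ R : ℝ, ∀ x ∈ T.spatialDomain, ∀ a, |E x a| ≤ R ∧ |B x a| ≤ R) (l : Coord dx dv) :
    ∃ R, ∀ z ∈ T.domain, |advection hx hv E B z l| ≤ R := by
  obtain ⟨R, hR⟩ := hEB
  have hz : ∃ S, 0 ≤ S ∧ ∀ z ∈ T.domain, ∀ l, |z l| ≤ S := by
    refine ⟨∑ l, (|T.pt l 0| + |T.pt l (Fin.last _)|), by positivity, fun z hz l => ?_⟩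
    refine le_trans ?_ (Finset.single_le_sum
      (f := fun l => |T.pt l 0| + |T.pt l (Fin.last _)|) (fun _ _ => by positivity)
      (Finset.mem_univ l))
    obtain ⟨h1, h2⟩ := hz l trivial
    have h3 := neg_abs_le (T.pt l 0)
    have h4 := le_abs_self (T.pt l (Fin.last _))
    exact abs_le.2 ⟨by linarith [abs_nonneg (T.pt l (Fin.last _))],
      by linarith [abs_nonneg (T.pt l 0)]⟩
  obtain ⟨S, hS0, hS⟩ := hz
  rcases l with l | l
  · exact ⟨S, fun z hz => hS z hz _⟩
  · refine ⟨R + (S * R + S * R), fun z hz => ?_⟩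
    have hx : (fun j => z (Sum.inl j)) ∈ T.spatialDomain := fun j _ => hz (Sum.inl j) trivial
    have hv' : ∀ a, |velocity z a| ≤ S := fun a => by
      unfold velocity
      split_ifs
      exacts [hS z hz _, by simpa using hS0]
    have hmul : ∀ a a', |velocity z a * B (fun j => z (Sum.inl j)) a'| ≤ S * R := fun a a' => by
      rw [abs_mul]
      exact mul_le_mul (hv' a) (hR _ hx a').2 (abs_nonneg _) hS0
    have hcross : ∀ a : Fin 3, |(velocity z ⨯₃ B (fun j => z (Sum.inl j))) a| ≤ S * R + S * R := by
      intro a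
      fin_cases a <;> simp only [cross_apply] <;>
        exact (abs_sub _ _).trans (add_le_add (hmul _ _) (hmul _ _))
    exact (abs_add_le _ _).trans (add_le_add (hR _ hx _).1 (hcross _))

/-- The velocity is a component of the advection field and vanishes on a null set only, so the time
step of the CFL condition is a genuine one even without fields. -/
theorem vecNormLinf_advection_pos (hdx : 1 ≤ dx) (hx : dx ≤ dv) (hv : dv ≤ 3)
    (T : Mesh (Coord dx dv)) {E B : (Fin dx → ℝ) → Fin 3 → ℝ}
    (h : ∀ l, MemLp (fun z => advection hx hv E B z l) ⊤ (volume.restrict T.domain)) :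
    0 < vecNormLinf T (advection hx hv E B) := by
  refine lt_of_le_of_ne (normLinf_nonneg _) fun h0 => ?_
  let l : Fin dx := ⟨0, hdx⟩
  have h1 := ae_abs_le_vecNormLinf h (Sum.inl l)
  rw [← h0] at h1
  have h2 : ∀ᵐ z ∂(volume.restrict T.domain), z (Sum.inr (Fin.castLE hx l)) ≠ 0 := by
    refine ae_restrict_of_ae ?_
    have := Measure.pi_hyperplane (fun _ : Coord dx dv => (volume : Measure ℝ))
      (Sum.inr (Fin.castLE hx l)) 0
    rw [ae_iff]
    simpa [volume_pi] using this
  have h3 : ∀ᵐ _z ∂(volume.restrict T.domain : Measure (Coord dx dv → ℝ)), False := by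
    filter_upwards [h1, h2] with z hz1 hz2
    exact hz2 (abs_nonpos_iff.1 hz1)
  have h4 : volume T.domain = 0 := by
    simpa [ae_iff] using h3
  rw [Mesh.domain, volume_pi_pi, Finset.prod_eq_zero_iff] at h4
  obtain ⟨l', -, hl'⟩ := h4
  rw [Real.volume_Ico, ENNReal.ofReal_eq_zero] at hl'
  have := T.pt_strictMono l' (Fin.lt_def.2 (T.cells_pos l') : (0 : Fin (T.cells l' + 1)) < Fin.last _)
  linarith

end

/-! ### The initial data and the energy estimate -/

theorem normSqL2_projection_le {ι : Type} [Fintype ι] [DecidableEq ι] (T : Mesh ι) {k : ℕ}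
    (r : Fin (k + 1) → ℝ) {f₀ : (ι → ℝ) → ℝ} (hf : MemLp f₀ 2 (volume.restrict T.domain))
    {u : Node T k → ℝ}
    (h : ∀ i, innerL2 T (feFun T r u) (basis T r i) = innerL2 T f₀ (basis T r i)) :
    normSqL2 T (feFun T r u) ≤ normSqL2 T f₀ := by
  have hu : MemLp (feFun T r u) 2 (volume.restrict T.domain) :=
    (memLp_feFun T r u _).mono_exponent le_top
  have hexp : ∀ {g : (ι → ℝ) → ℝ}, MemLp g 2 (volume.restrict T.domain) →
      ∑ i, u i * innerL2 T g (basis T r i) = ∫ z in T.domain, g z * feFun T r u z := by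
    intro g hg
    have hi : ∀ i, Integrable (fun z => g z * basis T r i z) (volume.restrict T.domain) := fun i =>
      hg.integrable_mul (q := 2) ((memLp_basis T r i _).mono_exponent le_top)
    simp_rw [innerL2, ← integral_const_mul]
    rw [← integral_finsetSum _ fun i _ => (hi i).const_mul _]
    congr 1
    ext z
    rw [feFun, Finset.mul_sum]
    exact Finset.sum_congr rfl fun i _ => by ring
  have heq : ∫ z in T.domain, feFun T r u z ^ 2 = ∫ z in T.domain, f₀ z * feFun T r u z := by
    rw [← hexp hf]
    simp_rw [← h]
    rw [hexp hu]
    simp_rw [sq]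
  have hsq : 0 ≤ ∫ z in T.domain, (f₀ z - feFun T r u z) ^ 2 := integral_nonneg fun _ => sq_nonneg _
  have hexpand : ∫ z in T.domain, (f₀ z - feFun T r u z) ^ 2 =
      (∫ z in T.domain, f₀ z ^ 2) - 2 * (∫ z in T.domain, f₀ z * feFun T r u z) +
        ∫ z in T.domain, feFun T r u z ^ 2 := by
    have h1 := hf.integrable_sq
    have h2 : Integrable (fun z => 2 * (f₀ z * feFun T r u z)) (volume.restrict T.domain) :=
      (hf.integrable_mul hu).const_mul 2
    have h3 : Integrable (fun z => f₀ z ^ 2 - 2 * (f₀ z * feFun T r u z))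
        (volume.restrict T.domain) := h1.sub h2
    rw [← integral_const_mul, ← integral_sub h1 h2, ← integral_add h3 hu.integrable_sq]
    exact integral_congr_ae (ae_of_all _ fun z => by ring)
  unfold normSqL2
  linarith

end VlasovFE

open VlasovFE
theorem mainTheorem1
    (dx dv : ℕ) (hdx : 1 ≤ dx) (hdxv : dx ≤ dv) (hdv : dv ≤ 3)
    (k : ℕ) (hk : 1 ≤ k)
    (r : Fin (k + 1) → ℝ) (hr : StrictMono r) (hr0 : r 0 = 0) (hr1 : r (Fin.last k) = 1)
    (σ : ℝ) (hσ : 1 ≤ σ) :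
    ∃ C : ℝ, 0 < C ∧
      ∀ (T : Mesh (Coord dx dv)) (_ : T.IsGraded σ)
        (δ : Coord dx dv → Node T k → ℝ) (_ : IsNodalMeshSize T δ)
        (lam : ℝ) (_ : 0 < lam)
        (N : ℕ) (t : ℕ → ℝ)
        (E B : ℕ → (Fin dx → ℝ) → Fin 3 → ℝ)
        (_ : ∀ n ≤ N, Measurable (E n) ∧ Measurable (B n) ∧
          ∃ R : ℝ, ∀ x ∈ T.spatialDomain, ∀ a, |E n x a| ≤ R ∧ |B n x a| ≤ R)
        (β : ℕ → (Coord dx dv → ℝ) → Coord dx dv → ℝ)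
        (_ : ∀ n, β n = advection hdxv hdv (E n) (B n))
        (A : ℕ → Coord dx dv → (Coord dx dv → ℝ) → ℝ)
        (_ : ∀ n l, A n l = visc T r δ (β n) l)
        (_ : ∀ n ≤ N, ∀ l, ∀ z ∈ T.domain, 0 ≤ A n l z)
        (_ : ∀ n ≤ N, t (n + 1) - t n = lam * (T.hMin / (k * vecNormLinf T (β n))))
        (f₀ : (Coord dx dv → ℝ) → ℝ) (_ : MemLp f₀ 2 (volume.restrict T.domain))
        (u : ℕ → Node T k → ℝ)
        (_ : ∀ i, innerL2 T (feFun T r (u 0)) (basis T r i) = innerL2 T f₀ (basis T r i))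
        (_ : ∀ n ≤ N, EulerStep T r (β n) (A n) (t (n + 1) - t n) (u n) (u (n + 1))),
        (∀ m ≤ N + 1,
          normSqL2 T (feFun T r (u m))
            + (1 - lam * C) * ∑ n ∈ Finset.range m,
                2 * (t (n + 1) - t n) * dissipation T (A n) (feFun T r (u n))
            ≤ normSqL2 T f₀) ∧
        (lam * C ≤ 1 →
          (⨆ m : Fin (N + 2), normSqL2 T (feFun T r (u m))) ≤ normSqL2 T f₀) := by
  have hk0 : 0 < k := hk
  have hk' : (0 : ℝ) < k := Nat.cast_pos.2 hk0
  have : Nonempty (Coord dx dv) := ⟨Sum.inl ⟨0, hdx⟩⟩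
  have hd : (0 : ℝ) < Fintype.card (Coord dx dv) := Nat.cast_pos.2 Fintype.card_pos
  obtain ⟨C₁, hC₁, hadv⟩ := exists_integral_advection_sq_le (ι := Coord dx dv) hk0 hr.injective
  obtain ⟨C₂, hC₂, hvisc⟩ := exists_integral_viscosity_le (ι := Coord dx dv) hk0 hr.injective hσ
  refine ⟨Fintype.card (Coord dx dv) * (C₁ + C₂) / k, by positivity, ?_⟩
  intro T hT δ hδ lam hlam N t E B hEB β hβ A hA hnn hcfl f₀ hf₀ u hu0 hstep
  set C : ℝ := Fintype.card (Coord dx dv) * (C₁ + C₂) / k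
  have hh : 0 < T.hMin := T.hMin_pos
  have hβm : ∀ n ≤ N, ∀ l, Measurable fun z => β n z l := fun n hn l => by
    rw [hβ]
    exact measurable_advection hdxv hdv (hEB n hn).1 (hEB n hn).2.1 l
  have hβb : ∀ n ≤ N, ∀ l, ∃ R, ∀ z ∈ T.domain, |β n z l| ≤ R := fun n hn l => by
    rw [hβ]
    exact exists_advection_bound hdxv hdv T (hEB n hn).2.2 l
  have hmem : ∀ n ≤ N, ∀ l, MemLp (fun z => β n z l) ⊤ (volume.restrict T.domain) :=
    fun n hn l => memLp_top_of_bounded_on_domain T (hβm n hn l) (hβb n hn l)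
  have hV : ∀ n ≤ N, 0 < vecNormLinf T (β n) := fun n hn => by
    have := hmem n hn
    rw [hβ] at this ⊢
    exact vecNormLinf_advection_pos hdx hdxv hdv T this
  have hτ : ∀ n ≤ N, 0 < t (n + 1) - t n := fun n hn => by
    have := hV n hn
    rw [hcfl n hn]
    positivity
  have hone : ∀ n ≤ N, normSqL2 T (feFun T r (u (n + 1))) + (1 - lam * C) *
      (2 * (t (n + 1) - t n) * dissipation T (A n) (feFun T r (u n))) ≤
        normSqL2 T (feFun T r (u n)) := by
    intro n hn
    have hVn := hV n hn
    set κ := vecNormLinf T (β n) / T.hMin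
    have hκ : 0 < κ := div_pos hVn hh
    have h := (hstep n hn).normSqL2_le hk0 hr.injective hr0 hr1 (hβm n hn) (hβb n hn)
      (fun l z s => by rw [hβ]; exact advection_update hdxv hdv _ _ l z s)
      (fun l => by rw [hA]; exact memLp_feFun T r _ _) (hnn n hn) (hτ n hn)
      (C₁ := C₁ * κ) (C₂ := C₂ * κ) (mul_pos hC₂ hκ)
      (fun l => by
        have h0 := hnn n hn l
        rw [hA] at h0 ⊢
        exact hadv T δ hδ (β n) (hmem n hn) l h0 hh (u n))
      (fun l w => by
        rw [hA]
        exact hvisc T hT δ hδ (β n) (hmem n hn) l hh w)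
    -- The CFL condition says that `τ ‖β‖_∞ / h_min = λ / k`.
    have hlamC : (t (n + 1) - t n) * (Fintype.card (Coord dx dv) * (C₁ * κ + C₂ * κ)) = lam * C := by
      rw [hcfl n hn]
      simp only [κ, C]
      field_simp
    rwa [hlamC] at h
  have hmain : ∀ m ≤ N + 1, normSqL2 T (feFun T r (u m)) + (1 - lam * C) *
      ∑ n ∈ Finset.range m, 2 * (t (n + 1) - t n) * dissipation T (A n) (feFun T r (u n)) ≤
        normSqL2 T f₀ := by
    intro m
    induction m with
    | zero => intro _; simpa using normSqL2_projection_le T r hf₀ hu0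
    | succ m ih =>
      intro hm
      have h1 := ih (by omega)
      have h2 := hone m (by omega)
      rw [Finset.sum_range_succ, mul_add]
      linarith
  refine ⟨hmain, fun hle => ciSup_le fun m => ?_⟩
  have hsum : 0 ≤ ∑ n ∈ Finset.range (m : ℕ),
      2 * (t (n + 1) - t n) * dissipation T (A n) (feFun T r (u n)) :=
    Finset.sum_nonneg fun n hn => by
      have hnm := Finset.mem_range.1 hn
      have := hτ n (by omega)
      exact mul_nonneg (by positivity) (dissipation_nonneg T _ _)
  have := hmain m (by omega)
  nlinarith [mul_nonneg (sub_nonneg.2 hle) hsum]
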